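/- Let $\mathbb F_q$ be a finite field and $A=\mathbb F_q[T]$. For an irreducible polynomial $f\in A[x]$ with leading coefficient in $A^\times=\mathbb F_q^\times$ (so that $R=A[x]/(f)$ is an $A$-order in its fraction field) and a nonzero prime ideal $\mathfrak p=(P)$ of $A$, let $R_{\mathfrak p}=\varprojlim_n R/\mathfrak p^nR$ and let $K_{\mathfrak p}$ be the total ring of fractions of $R_{\mathfrak p}$. The ideal class monoid $\mathrm{ICM}(R_{\mathfrak p})$ is the monoid, under multiplication, of the fractional $R_{\mathfrak p}$-ideals in $K_{\mathfrak p}$ that contain a unit of $K_{\mathfrak p}$, modulo the relation $I\sim J\iff I=xJ$ for some $x\in K_{\mathfrak p}^\times$. Then $\mathrm{ICM}(R_{\mathfrak p})$ is finite and can be computed: for each fixed $\mathbb F_q$ there is an algorithm (a partial recursive function) which, given the coefficients of any such $f$ and of any irreducible $P\in A$, halts and returns 1. a finite list of ideals $I_1,\dots,I_n$ of $R$, each given by a finite list of generators (polynomials in $A[x]$ taken modulo $f$), such that every class of $\mathrm{ICM}(R_{\mathfrak p})$ is the class of $I_iR_{\mathfrak p}$ for exactly one $i$; and 2. the multiplication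 table of $\mathrm{ICM}(R_{\mathfrak p})$ with respect to this list, i.e. for all $i,j$ the index $m$ such that $I_iI_jR_{\mathfrak p}\sim I_mR_{\mathfrak p}$. -/

import Mathlib

open scoped Polynomial

noncomputable section

namespace IdealClasses

/-- The monoid of full fractional ideals of a commutative ring `R`: the fractional ideals in the
total ring of fractions of `R` that contain a unit of it. For a domain these are the nonzero
fractional ideals; for an order in a product of fields they are the fractional ideals that are
full lattices. -/
def fullFractionalIdeals (R : Type*) [CommRing R] :
    Submonoid (FractionalIdeal (nonZeroDivisors R) (FractionRing R)) where
  carrier := {I | ∃ x ∈ I, IsUnit x}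
  one_mem' := ⟨1, FractionalIdeal.one_mem_one _, isUnit_one⟩
  mul_mem' := by
    rintro I J ⟨x, hx, ux⟩ ⟨y, hy, uy⟩
    exact ⟨x * y, FractionalIdeal.mul_mem_mul hx hy, ux.mul uy⟩

/-- Two full fractional ideals are equivalent if they differ by a principal factor `x R`, with
`x` a unit of the total ring of fractions. -/
def principalCon (R : Type*) [CommRing R] : Con (fullFractionalIdeals R) where
  r I J := ∃ x : (FractionRing R)ˣ,
    (I : FractionalIdeal (nonZeroDivisors R) (FractionRing R)) =
      FractionalIdeal.spanSingleton (nonZeroDivisors R) (x : FractionRing R) * J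
  iseqv := by
    refine ⟨fun I => ⟨1, by simp⟩, ?_, ?_⟩
    · rintro I J ⟨x, hx⟩
      refine ⟨x⁻¹, ?_⟩
      rw [hx, ← mul_assoc, FractionalIdeal.spanSingleton_mul_spanSingleton]
      simp
    · rintro I J L ⟨x, hx⟩ ⟨y, hy⟩
      refine ⟨x * y, ?_⟩
      rw [hx, hy, ← mul_assoc, FractionalIdeal.spanSingleton_mul_spanSingleton]
      simp
  mul' := by
    rintro I J L M ⟨x, hx⟩ ⟨y, hy⟩
    refine ⟨x * y, ?_⟩
    rw [Submonoid.coe_mul, Submonoid.coe_mul, hx, hy, Units.val_mul,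
      ← FractionalIdeal.spanSingleton_mul_spanSingleton, mul_mul_mul_comm]

/-- The ideal class monoid: full fractional ideals modulo principal ones. -/
abbrev ICM (R : Type*) [CommRing R] := (principalCon R).Quotient

variable {k : Type*} [Field k]

/-- The completion `R_P` of `R = k[T][x]/(f)` at the prime `(P)` of `k[T]`, that is, the inverse
limit of the rings `R / P ^ n R`. -/
abbrev CompletedOrder (f : k[X][X]) (P : k[X]) :=
  AdicCompletion ((Ideal.span {P}).map (algebraMap k[X] (AdjoinRoot f))) (AdjoinRoot f)

/-- The ideal of `R_P` generated by the residue classes in `R = k[T][x]/(f)` of the members of a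
list of polynomials, i.e. the completion of the ideal of `R` which they generate. -/
def completedIdeal (f : k[X][X]) (P : k[X]) (gens : List k[X][X]) : Ideal (CompletedOrder f P) :=
  Ideal.span {y | ∃ g ∈ gens,
    y = algebraMap (AdjoinRoot f) (CompletedOrder f P) (AdjoinRoot.mk f g)}

/-- The list `gens` generates a full ideal of `R_P`, and `c` is the class of that ideal. -/
def Represents (f : k[X][X]) (P : k[X]) (gens : List k[X][X]) (c : ICM (CompletedOrder f P)) :
    Prop :=
  ∃ I : fullFractionalIdeals (CompletedOrder f P),
    (I : FractionalIdeal (nonZeroDivisors (CompletedOrder f P))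
      (FractionRing (CompletedOrder f P))) = (completedIdeal f P gens : FractionalIdeal _ _) ∧
    (I : ICM (CompletedOrder f P)) = c

/-- The polynomial with a given list of coefficients, constant coefficient first. -/
def ofCoeffs {S : Type*} [Semiring S] : List S → S[X]
  | [] => 0
  | a :: l => Polynomial.C a + Polynomial.X * ofCoeffs l

/-- The polynomial over `k[T]` with a given list of coefficients, each of them given by its own
list of coefficients. -/
def ofCoeffs₂ (l : List (List k)) : k[X][X] := ofCoeffs (l.map ofCoeffs)

/-- The finite data `(reps, table)` describe the monoid `ICM R_P`: the members of `reps` are lists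
of generators of ideals that represent each class exactly once, and the entry of `table` in row `i`
and column `j` is the index of the product of the `i`-th and the `j`-th class. -/
def DescribesICM (f : k[X][X]) (P : k[X])
    (out : List (List (List (List k))) × List (List ℕ)) : Prop :=
  ∃ e : Fin out.1.length ≃ ICM (CompletedOrder f P),
    (∀ i, Represents f P ((out.1.get i).map ofCoeffs₂) (e i)) ∧
    ∀ i j : Fin out.1.length, ∃ m : Fin out.1.length,
      (∃ row, out.2[(i : ℕ)]? = some row ∧ row[(j : ℕ)]? = some (m : ℕ)) ∧ e i * e j = e m

end IdealClasses

end

/-! Let `S` be the completed order and `p` the image of `P` in it. Then `p` is a non-zero-divisor,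
`S` is `p`-adically complete and all `S / p ^ n` are finite. By compactness and counting, every
non-zero-divisor of `S` divides a power of `p` (`exists_dvd_pow`). Hence each class contains an
ideal of `S` in which some power of `p` lies.

This power can be bounded uniformly. The normalization `O` of `R` is a Dedekind domain and finite
over `R` (`normalization_finite`). Inseparability in `x` is removed by a shear, after which `T` is a
separable generator. So `D * O ⊆ R` for some `D ≠ 0`; let `C = D * O`. An ideal of `O` is generated
by any prescribed nonzero element of it together with one more. If the prescribed element is a high
power of `P`, Nakayama's lemma removes it in the completion, and `D I C = a C` remains. The ideal
`a⁻¹ D² I` is then integral and contains `D²`, so one power `p ^ t` lies in suitable representatives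
of all classes (`exists_bound`), and there are finitely many classes.

For two ideals that contain `p ^ m`, equivalence can be read off modulo `p ^ N` as soon as `N > 2 *
m` (`sameClass_iff`). Products and inclusions are also visible there, so everything takes place in
the finite ring `A[x] / (f, P ^ N)`.

The algorithm does not compute `t`. It runs through all pairs of an output and a certificate, the
latter being a finite model of this ring for some `t`. That no class is missing is checked locally:
the list meets the trivial class and is closed, up to equivalence, under passage from `L` to the
ideals between `p L` and `L`. This suffices because each ideal `I` is reached along the chain `I +
(p ^ s)` (`exists_sameClass_of_neighbours`). Checking a certificate is primitive recursive. An
accepted certificate makes the output correct (`exists_equiv_of_certifies`), and the bound `t`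
guarantees that one exists (`exists_certifies`), so the search halts. -/

namespace IdealClasses

/-! ### Complete rings with finite quotients: non-zero-divisors divide powers of `p` -/

/-- A commutative ring `S` is *finitely complete* at `p` if `p` is a non-zero-divisor, `S` is
`p`-adically complete and all quotients `S / p ^ n` are finite. -/
structure FinitelyComplete {S : Type*} [CommRing S] (p : S) : Prop where
  mem_nonZeroDivisors : p ∈ nonZeroDivisors S
  finite_quotient : ∀ n, Finite (S ⧸ Ideal.span {p ^ n})
  complete : IsAdicComplete (Ideal.span {p}) S

namespace FinitelyComplete

variable {S : Type*} [CommRing S] {p : S}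

theorem isUnit_one_add_mul (h : FinitelyComplete p) (s : S) : IsUnit (1 + p * s) := by
  have := h.complete
  have hj := IsAdicComplete.le_jacobson_bot (Ideal.span {p})
  have := Ideal.mem_jacobson_bot.1 (hj (Ideal.mem_span_singleton_self p)) s
  rwa [add_comm]

theorem pow_mem (h : FinitelyComplete p) (n : ℕ) : p ^ n ∈ nonZeroDivisors S :=
  Submonoid.pow_mem _ h.mem_nonZeroDivisors n

theorem dvd_of_pow_mul_dvd (h : FinitelyComplete p) {n : ℕ} {a b : S} (hab : p ^ n * a ∣ p ^ n * b) :
    a ∣ b := by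
  obtain ⟨c, hc⟩ := hab
  refine ⟨c, ?_⟩
  rw [mul_assoc] at hc
  exact (mul_cancel_left_mem_nonZeroDivisors (h.pow_mem n)).1 hc

theorem exists_limit (h : FinitelyComplete p) (c : ℕ → S) (hc : ∀ n, p ^ n ∣ c (n + 1) - c n) :
    ∃ y, ∀ n, p ^ n ∣ y - c n := by
  have := h.complete
  have hmn : ∀ {m n}, m ≤ n → p ^ m ∣ c n - c m := by
    intro m n hmn
    induction n, hmn using Nat.le_induction with
    | base => simp
    | succ n hmn ih =>
      have : c (n + 1) - c m = (c (n + 1) - c n) + (c n - c m) := by ring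
      rw [this]
      exact dvd_add ((pow_dvd_pow p hmn).trans (hc n)) ih
  obtain ⟨y, hy⟩ := IsPrecomplete.prec (I := Ideal.span {p}) (M := S) inferInstance
    (f := c) (fun {m n} hm => by
      rw [SModEq.comm, SModEq.sub_mem, smul_eq_mul, Ideal.mul_top, Ideal.span_singleton_pow,
        Ideal.mem_span_singleton]
      exact hmn hm)
  refine ⟨y, fun n => ?_⟩
  have := hy n
  rwa [SModEq.comm, SModEq.sub_mem, smul_eq_mul, Ideal.mul_top, Ideal.span_singleton_pow,
        Ideal.mem_span_singleton] at this

theorem eq_zero_of_forall_dvd (h : FinitelyComplete p) {y : S} (hy : ∀ n, p ^ n ∣ y) : y = 0 := by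
  have := h.complete
  refine IsHausdorff.haus (I := Ideal.span {p}) (M := S) inferInstance y fun n => ?_
  rw [SModEq.sub_mem, sub_zero, smul_eq_mul, Ideal.mul_top, Ideal.span_singleton_pow,
        Ideal.mem_span_singleton]
  exact hy n

/-- Compactness: a condition that can be approximated modulo all powers of `p` near `c` can be
approximated near a refinement of `c`. -/
theorem exists_refinement (h : FinitelyComplete p) (Q : ℕ → S → Prop)
    (hQ : ∀ {m n y}, m ≤ n → Q n y → Q m y) (n : ℕ) (c : S)
    (hc : ∀ N, ∃ y, p ^ n ∣ y - c ∧ Q N y) :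
    ∃ c', p ^ n ∣ c' - c ∧ ∀ N, ∃ y, p ^ (n + 1) ∣ y - c' ∧ Q N y := by
  by_contra! hcon
  have := h.finite_quotient (n + 1)
  choose y hy hQy using hc
  -- Each residue class modulo `p ^ (n + 1)` is avoided by the sequence `y` from some index on.
  -- There are finitely many classes, so at the largest of these indices `y` would lie in none.
  have hcon' : ∀ q : S ⧸ Ideal.span {p ^ (n + 1)}, ∃ N, ∀ N', N ≤ N' →
      Ideal.Quotient.mk _ (y N') ≠ q := by
    intro q
    obtain ⟨c', rfl⟩ := Ideal.Quotient.mk_surjective q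
    by_cases hcc : p ^ n ∣ c' - c
    · obtain ⟨N, hN⟩ := hcon c' hcc
      refine ⟨N, fun N' hN' he => ?_⟩
      rw [Ideal.Quotient.eq, Ideal.mem_span_singleton] at he
      exact hN (y N') he (hQ hN' (hQy N'))
    · refine ⟨0, fun N' _ he => hcc ?_⟩
      rw [Ideal.Quotient.eq, Ideal.mem_span_singleton] at he
      have : c' - c = (y N' - c) - (y N' - c') := by ring
      rw [this]
      exact dvd_sub (hy N') ((pow_dvd_pow p n.le_succ).trans he)
  choose N hN using hcon'
  cases nonempty_fintype (S ⧸ Ideal.span {p ^ (n + 1)})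
  exact hN _ (Finset.univ.sup N) (Finset.le_sup (Finset.mem_univ _)) rfl

/-- Otherwise for each `N` some `y` outside `(p)` satisfies `p ^ N ∣ s * y`. Successive refinement
gives a limit of such elements, which is still outside `(p)` and is annihilated by `s`. -/
theorem exists_dvd_of_pow_dvd_mul (h : FinitelyComplete p) {s : S} (hs : s ∈ nonZeroDivisors S) :
    ∃ n, ∀ y, p ^ n ∣ s * y → p ∣ y := by
  by_contra! hcon
  let Q : ℕ → S → Prop := fun N y => p ^ N ∣ s * y ∧ ¬ p ∣ y
  have hQ : ∀ {m n y}, m ≤ n → Q n y → Q m y := fun hmn hy =>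
    ⟨(pow_dvd_pow p hmn).trans hy.1, hy.2⟩
  let X := {x : ℕ × S // ∀ N, ∃ y, p ^ x.1 ∣ y - x.2 ∧ Q N y}
  have hX : ∀ x : X, ∃ x' : X, x'.1.1 = x.1.1 + 1 ∧ p ^ x.1.1 ∣ x'.1.2 - x.1.2 := by
    rintro ⟨⟨n, c⟩, hc⟩
    obtain ⟨c', h1, h2⟩ := h.exists_refinement Q hQ n c hc
    exact ⟨⟨(n + 1, c'), h2⟩, rfl, h1⟩
  choose F hF1 hF2 using hX
  let x : ℕ → X := fun n => Nat.rec ⟨(0, 0), fun N => by simpa [Q] using hcon N⟩ (fun _ => F) n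
  have hx : ∀ n, (x n).1.1 = n := by
    intro n
    induction n with
    | zero => rfl
    | succ n ih => exact (hF1 (x n)).trans (congrArg (· + 1) ih)
  obtain ⟨y, hy⟩ := h.exists_limit (fun n => (x n).1.2) (fun n => by
    have := hF2 (x n)
    rwa [hx n] at this)
  have key : ∀ n, p ^ n ∣ s * y ∧ (1 ≤ n → ¬ p ∣ y) := by
    intro n
    obtain ⟨z, hz, hz1, hz2⟩ := (x n).2 n
    rw [hx n] at hz
    have hzy : p ^ n ∣ z - y := by
      have : z - y = (z - (x n).1.2) - (y - (x n).1.2) := by ring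
      rw [this]
      exact dvd_sub hz (hy n)
    constructor
    · have : s * y = s * z - s * (z - y) := by ring
      rw [this]
      exact dvd_sub hz1 (hzy.mul_left s)
    · intro hn hpy
      refine hz2 ?_
      have : z = (z - y) + y := by ring
      rw [this]
      exact dvd_add ((dvd_pow_self p (by lia)).trans hzy) hpy
  have hy0 : s * y = 0 := h.eq_zero_of_forall_dvd fun n => (key n).1
  have : y = 0 := (mul_left_mem_nonZeroDivisors_eq_zero_iff hs).1 hy0
  exact (key 1).2 le_rfl (this ▸ dvd_zero p)

/-- A residue modulo `p ^ (a + b)` is a chosen residue modulo `p ^ a` plus `p ^ a * y`, where `y`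
matters only modulo `p ^ b`. -/
theorem card_quotient_add_le (h : FinitelyComplete p) (a b : ℕ) :
    Nat.card (S ⧸ Ideal.span {p ^ (a + b)}) ≤
      Nat.card (S ⧸ Ideal.span {p ^ a}) * Nat.card (S ⧸ Ideal.span {p ^ b}) := by
  have := h.finite_quotient a
  have := h.finite_quotient b
  rw [← Nat.card_prod]
  have hr : ∀ q : S ⧸ Ideal.span {p ^ (a + b)}, ∃ (x y : S),
      q = Ideal.Quotient.mk _ ((Ideal.Quotient.mk (Ideal.span {p ^ a}) x).out + p ^ a * y) := by
    intro q
    obtain ⟨x, rfl⟩ := Ideal.Quotient.mk_surjective q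
    have : Ideal.Quotient.mk (Ideal.span {p ^ a}) x =
      Ideal.Quotient.mk _ ((Ideal.Quotient.mk (Ideal.span {p ^ a}) x).out) :=
      (Quotient.out_eq' _).symm
    rw [Ideal.Quotient.eq, Ideal.mem_span_singleton] at this
    obtain ⟨y, hy⟩ := this
    exact ⟨x, y, by rw [← hy]; simp⟩
  choose x y hxy using hr
  refine Nat.card_le_card_of_injective (fun q => (Ideal.Quotient.mk _ (x q), Ideal.Quotient.mk _ (y q)))
    fun q q' hq => ?_
  simp only [Prod.mk.injEq] at hq
  rw [hxy q, hxy q', hq.1, Ideal.Quotient.eq, Ideal.mem_span_singleton]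
  have := hq.2
  rw [Ideal.Quotient.eq, Ideal.mem_span_singleton] at this
  rw [add_sub_add_left_eq_sub, ← mul_sub, pow_add]
  exact mul_dvd_mul_left _ this

/-- Every non-zero-divisor divides a power of `p`. -/
theorem exists_dvd_pow (h : FinitelyComplete p) {s : S} (hs : s ∈ nonZeroDivisors S) :
    ∃ n, s ∣ p ^ n := by
  obtain ⟨n, hn⟩ := h.exists_dvd_of_pow_dvd_mul hs
  have hn' : ∀ j y, p ^ (n + j) ∣ s * y → p ^ (j + 1) ∣ y := by
    intro j
    induction j with
    | zero => intro y hy; simpa using hn y (by simpa using hy)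
    | succ j ih =>
      intro y hy
      obtain ⟨z, rfl⟩ := hn y ((pow_dvd_pow p (by lia)).trans hy)
      rw [pow_succ' p (j + 1)]
      refine mul_dvd_mul_left p (ih z ?_)
      refine h.dvd_of_pow_mul_dvd (n := 1) ?_
      rw [← pow_add, pow_one, mul_left_comm]
      convert hy using 2
      lia
  -- The map `(u, v) ↦ s * u + v` on chosen representatives embeds `S / p ^ (j + 1) × S / I (n + j)`
  -- into `S / p ^ (n + j)`. Comparing cardinalities bounds `S / I M` independently of `M`, so this
  -- increasing sequence of cardinalities must stall.
  let I : ℕ → Ideal S := fun M => Ideal.span {s} ⊔ Ideal.span {p ^ M}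
  have hIfin : ∀ M, Finite (S ⧸ I M) := fun M => by
    have := h.finite_quotient M
    exact Finite.of_surjective (Ideal.Quotient.factor (le_sup_right : Ideal.span {p ^ M} ≤ I M))
      (Ideal.Quotient.factor_surjective _)
  have hanti : ∀ M, I (M + 1) ≤ I M := fun M =>
    sup_le_sup le_rfl (Ideal.span_singleton_le_span_singleton.2 (pow_dvd_pow p M.le_succ))
  have hbound : ∀ j, Nat.card (S ⧸ I (n + j)) ≤ Nat.card (S ⧸ Ideal.span {p ^ n}) := by
    intro j
    have f1 := h.finite_quotient (j + 1)
    have f2 := h.finite_quotient (n + j)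
    have f3 := h.finite_quotient j
    have f4 := h.finite_quotient n
    have f5 := hIfin (n + j)
    have h1 : Nat.card (S ⧸ Ideal.span {p ^ (j + 1)}) * Nat.card (S ⧸ I (n + j)) ≤
        Nat.card (S ⧸ Ideal.span {p ^ (n + j)}) := by
      rw [← Nat.card_prod]
      refine Nat.card_le_card_of_injective
        (fun q => Ideal.Quotient.mk _ (s * q.1.out + q.2.out)) fun q q' hq => ?_
      simp only at hq
      rw [Ideal.Quotient.eq, Ideal.mem_span_singleton] at hq
      have e2 : q.2 = q'.2 := by
        rw [← Quotient.out_eq' q.2, ← Quotient.out_eq' q'.2]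
        refine (Ideal.Quotient.eq (I := I (n + j))).2 ?_
        have : q.2.out - q'.2.out = s * (q'.1.out - q.1.out) +
          (s * q.1.out + q.2.out - (s * q'.1.out + q'.2.out)) := by ring
        rw [this]
        exact Ideal.add_mem _ (Ideal.mem_sup_left (Ideal.mem_span_singleton.2 (dvd_mul_right _ _)))
          (Ideal.mem_sup_right (Ideal.mem_span_singleton.2 hq))
      rw [e2, add_sub_add_right_eq_sub, ← mul_sub] at hq
      have e1 : q.1 = q'.1 := by
        rw [← Quotient.out_eq' q.1, ← Quotient.out_eq' q'.1]
        exact (Ideal.Quotient.eq (I := Ideal.span {p ^ (j + 1)})).2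
          (Ideal.mem_span_singleton.2 (hn' j _ hq))
      exact Prod.ext e1 e2
    have h2 := h.card_quotient_add_le n j
    have h3 : Nat.card (S ⧸ Ideal.span {p ^ j}) ≤ Nat.card (S ⧸ Ideal.span {p ^ (j + 1)}) :=
      Nat.card_le_card_of_surjective _ (Ideal.Quotient.factor_surjective
        (Ideal.span_singleton_le_span_singleton.2 (pow_dvd_pow p j.le_succ)))
    have h4 : 0 < Nat.card (S ⧸ Ideal.span {p ^ (j + 1)}) := Nat.card_pos
    refine Nat.le_of_mul_le_mul_left (h1.trans (h2.trans ?_)) h4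
    rw [mul_comm]
    exact Nat.mul_le_mul_right _ h3
  have hmono : ∀ M, Nat.card (S ⧸ I M) ≤ Nat.card (S ⧸ I (M + 1)) := fun M => by
    have := hIfin (M + 1)
    exact Nat.card_le_card_of_surjective _ (Ideal.Quotient.factor_surjective (hanti M))
  obtain ⟨M, hM⟩ : ∃ M, Nat.card (S ⧸ I M) = Nat.card (S ⧸ I (M + 1)) := by
    by_contra! hne
    have hlt : ∀ M, M ≤ Nat.card (S ⧸ I M) := by
      intro M
      induction M with
      | zero => exact Nat.zero_le _
      | succ M ih => exact Nat.succ_le_of_lt (ih.trans_lt ((hmono M).lt_of_ne (hne M)))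
    have a := hlt (n + (Nat.card (S ⧸ Ideal.span {p ^ n}) + 1))
    have b := hbound (Nat.card (S ⧸ Ideal.span {p ^ n}) + 1)
    lia
  have := hIfin M
  have := hIfin (M + 1)
  have hinj : Function.Injective (Ideal.Quotient.factor (hanti M)) :=
    (Function.Surjective.bijective_of_nat_card_le (Ideal.Quotient.factor_surjective (hanti M))
      hM.ge).1
  -- Where the sequence stalls, `p ^ M = s * c + p ^ (M + 1) * e`, and `1 - p * e` is a unit.
  have hmem : p ^ M ∈ I (M + 1) := by
    rw [← Ideal.Quotient.eq_zero_iff_mem]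
    refine hinj ?_
    rw [map_zero, Ideal.Quotient.factor_mk, Ideal.Quotient.eq_zero_iff_mem]
    exact Ideal.mem_sup_right (Ideal.mem_span_singleton_self _)
  obtain ⟨a, ha, b, hb, hab⟩ := Submodule.mem_sup.1 hmem
  obtain ⟨c, rfl⟩ := Ideal.mem_span_singleton.1 ha
  obtain ⟨e, rfl⟩ := Ideal.mem_span_singleton.1 hb
  refine ⟨M, (h.isUnit_one_add_mul (-e)).dvd_mul_right.1 ⟨c, ?_⟩⟩
  linear_combination -hab

end FinitelyComplete

/-! ### Ideal classes in terms of integral ideals -/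

section SameClass

variable {S : Type*} [CommRing S]

/-- Two ideals are in the same class if they agree up to non-zero-divisors. -/
def SameClass (I J : Ideal S) : Prop :=
  ∃ a ∈ nonZeroDivisors S, ∃ b ∈ nonZeroDivisors S, Ideal.span {a} * I = Ideal.span {b} * J

theorem SameClass.symm {I J : Ideal S} : SameClass I J → SameClass J I :=
  fun ⟨a, ha, b, hb, h⟩ => ⟨b, hb, a, ha, h.symm⟩

theorem SameClass.trans {I J L : Ideal S} : SameClass I J → SameClass J L → SameClass I L := by
  rintro ⟨a, ha, b, hb, h⟩ ⟨c, hc, d, hd, h'⟩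
  refine ⟨c * a, mul_mem hc ha, b * d, mul_mem hb hd, ?_⟩
  rw [← Ideal.span_singleton_mul_span_singleton, mul_assoc, h, mul_left_comm, h', ← mul_assoc,
    Ideal.span_singleton_mul_span_singleton]

/-- An ideal that contains a non-zero-divisor, as a full fractional ideal. -/
def fullOfIdeal (I : Ideal S) (hI : ∃ x ∈ I, x ∈ nonZeroDivisors S) : fullFractionalIdeals S :=
  ⟨(I : FractionalIdeal (nonZeroDivisors S) (FractionRing S)), by
    obtain ⟨x, hx, hx'⟩ := hI
    exact ⟨algebraMap S _ x, FractionalIdeal.mem_coeIdeal_of_mem _ hx,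
      IsLocalization.map_units (FractionRing S) ⟨x, hx'⟩⟩⟩

/-- The class of an ideal that contains a non-zero-divisor. -/
def classOfIdeal (I : Ideal S) (hI : ∃ x ∈ I, x ∈ nonZeroDivisors S) : ICM S :=
  (fullOfIdeal I hI : ICM S)

/-- A unit of the total ring of fractions is a quotient `b / a` of non-zero-divisors, so clearing
denominators moves the comparison into `S`. -/
theorem classOfIdeal_eq_iff {I J : Ideal S} (hI : ∃ x ∈ I, x ∈ nonZeroDivisors S)
    (hJ : ∃ x ∈ J, x ∈ nonZeroDivisors S) :
    classOfIdeal I hI = classOfIdeal J hJ ↔ SameClass I J := by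
  have key : ∀ a b : S, Ideal.span {a} * I = Ideal.span {b} * J ↔
      FractionalIdeal.spanSingleton (nonZeroDivisors S) (algebraMap S (FractionRing S) a) *
        (I : FractionalIdeal (nonZeroDivisors S) (FractionRing S)) =
      FractionalIdeal.spanSingleton (nonZeroDivisors S) (algebraMap S (FractionRing S) b) * J := by
    intro a b
    rw [← FractionalIdeal.coeIdeal_span_singleton, ← FractionalIdeal.coeIdeal_span_singleton,
      ← FractionalIdeal.coeIdeal_mul, ← FractionalIdeal.coeIdeal_mul,
      FractionalIdeal.coeIdeal_inj' le_rfl]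
  refine (Con.eq _).trans ⟨?_, ?_⟩
  · rintro ⟨x, hx⟩
    change (I : FractionalIdeal (nonZeroDivisors S) (FractionRing S)) = _ * (J : FractionalIdeal _ _) at hx
    obtain ⟨⟨b, a⟩, hab⟩ := IsLocalization.surj (nonZeroDivisors S) (x : FractionRing S)
    have ha := IsLocalization.map_units (FractionRing S) a
    refine ⟨a, a.2, b, ?_, (key _ _).2 ?_⟩
    · have hb : IsUnit (algebraMap S (FractionRing S) b) := hab ▸ x.isUnit.mul ha
      exact mem_nonZeroDivisors_of_injective (IsFractionRing.injective S (FractionRing S))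
        hb.mem_nonZeroDivisors
    · rw [hx, ← mul_assoc, FractionalIdeal.spanSingleton_mul_spanSingleton, mul_comm, ← hab,
        mul_comm]
      simp [mul_comm]
  · rintro ⟨a, ha, b, hb, hab⟩
    have hua := IsLocalization.map_units (FractionRing S) (⟨a, ha⟩ : nonZeroDivisors S)
    have hub := IsLocalization.map_units (FractionRing S) (⟨b, hb⟩ : nonZeroDivisors S)
    refine ⟨hua.unit⁻¹ * hub.unit, ?_⟩
    change (I : FractionalIdeal (nonZeroDivisors S) (FractionRing S)) = _ * (J : FractionalIdeal _ _)
    rw [Units.val_mul, ← FractionalIdeal.spanSingleton_mul_spanSingleton, mul_assoc]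
    have := (key a b).1 hab
    erw [← this]
    rw [← mul_assoc, FractionalIdeal.spanSingleton_mul_spanSingleton]
    simp

theorem classOfIdeal_mul {I J : Ideal S} (hI : ∃ x ∈ I, x ∈ nonZeroDivisors S)
    (hJ : ∃ x ∈ J, x ∈ nonZeroDivisors S) (hIJ : ∃ x ∈ I * J, x ∈ nonZeroDivisors S) :
    classOfIdeal I hI * classOfIdeal J hJ = classOfIdeal (I * J) hIJ := by
  have : fullOfIdeal I hI * fullOfIdeal J hJ = fullOfIdeal (I * J) hIJ :=
    Subtype.ext (FractionalIdeal.coeIdeal_mul I J).symm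
  exact congrArg (fun F : fullFractionalIdeals S => (F : ICM S)) this

theorem exists_classOfIdeal_eq (c : ICM S) : ∃ I hI, classOfIdeal (S := S) I hI = c := by
  induction c using Con.induction_on with
  | H c =>
  obtain ⟨F, x, hx, hux⟩ := c
  have hden := F.den_mul_self_eq_num'
  have hd := IsLocalization.map_units (FractionRing S) F.den
  have hmem : algebraMap S (FractionRing S) F.den * x ∈
      (F.num : FractionalIdeal (nonZeroDivisors S) (FractionRing S)) := by
    rw [← hden]
    exact FractionalIdeal.mul_mem_mul (FractionalIdeal.mem_spanSingleton_self _ _) hx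
  obtain ⟨r, hr, hrx⟩ := (FractionalIdeal.mem_coeIdeal _).1 hmem
  refine ⟨F.num, ⟨r, hr, ?_⟩, (Con.eq _).2 ⟨hd.unit, hden.symm⟩⟩
  exact mem_nonZeroDivisors_of_injective (IsFractionRing.injective S (FractionRing S))
    (hrx ▸ (hd.mul hux).mem_nonZeroDivisors)

end SameClass

/-! ### Comparison, exhaustion and finiteness of classes -/

namespace FinitelyComplete

variable {S : Type*} [CommRing S] {p : S}

/-- Two ideals that contain `p ^ m` are in the same class if and only if this can be seen
modulo `p ^ N`, for any `N > 2 * m`. -/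
theorem sameClass_iff (h : FinitelyComplete p) {I J : Ideal S} {m N : ℕ} (hI : p ^ m ∈ I)
    (hJ : p ^ m ∈ J) (hN : 2 * m < N) :
    SameClass I J ↔ ∃ y z, p ^ N ∣ y * z - p ^ (2 * m) ∧
      (∀ a ∈ I, ∃ b ∈ J, p ^ N ∣ y * a - p ^ m * b) ∧ ∀ b ∈ J, ∃ a ∈ I, p ^ N ∣ z * b - p ^ m * a := by
  have hpm := h.pow_mem m
  constructor
  · rintro ⟨a, ha, b, hb, hab⟩
    have tr : ∀ {I J : Ideal S} {a b : S}, Ideal.span {a} * I = Ideal.span {b} * J →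
        ∀ i ∈ I, ∃ j ∈ J, b * j = a * i := fun hab i hi =>
      Ideal.mem_span_singleton_mul.1 (hab ▸ Ideal.mul_mem_mul (Ideal.mem_span_singleton_self _) hi)
    -- The witnesses are `y = p ^ m * a / b` and `z = p ^ m * b / a`. They are integral because `p ^
    -- m` lies in both ideals.
    obtain ⟨y, hy, hay⟩ := tr hab _ hI
    obtain ⟨z, hz, hbz⟩ := tr hab.symm _ hJ
    refine ⟨y, z, ?_, fun i hi => ?_, fun j hj => ?_⟩
    · have : y * z = p ^ (2 * m) := by
        rw [← mul_cancel_left_mem_nonZeroDivisors (mul_mem ha hb), two_mul, pow_add]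
        linear_combination a * z * hay + a * p ^ m * hbz
      simp [this]
    · obtain ⟨j, hj, hij⟩ := tr hab i hi
      refine ⟨j, hj, ?_⟩
      have : y * i = p ^ m * j := by
        rw [← mul_cancel_left_mem_nonZeroDivisors hb]
        linear_combination i * hay - p ^ m * hij
      simp [this]
    · obtain ⟨i, hi, hij⟩ := tr hab.symm j hj
      refine ⟨i, hi, ?_⟩
      have : z * j = p ^ m * i := by
        rw [← mul_cancel_left_mem_nonZeroDivisors ha]
        linear_combination j * hbz - p ^ m * hij
      simp [this]
  · rintro ⟨y, z, ⟨e, he⟩, h1, h2⟩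
    -- With `N = 2 * m + r + 1` the error in `y * z` is `p ^ (2 * m)` times a multiple of `p`, so `y
    -- * z` is `p ^ (2 * m)` times a unit. In the other congruences `p ^ m` can be divided out of
    -- the error, and what is left is still a multiple of `p ^ m`, hence lies in the ideal and can
    -- be absorbed.
    obtain ⟨r, rfl⟩ := Nat.exists_eq_add_of_lt hN
    obtain ⟨u, hu⟩ := h.isUnit_one_add_mul (p ^ r * e)
    have hyz : y * z = p ^ (2 * m) * u := by
      rw [hu]
      linear_combination he
    have hy : y ∈ nonZeroDivisors S := by
      have : y * z ∈ nonZeroDivisors S := hyz ▸ mul_mem (h.pow_mem _) u.isUnit.mem_nonZeroDivisors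
      exact (mul_mem_nonZeroDivisors.1 this).1
    have red : ∀ {w a b : S} {I : Ideal S}, p ^ m ∈ I → b ∈ I →
        p ^ (2 * m + r + 1) ∣ w * a - p ^ m * b → ∃ b' ∈ I, w * a = p ^ m * b' := by
      rintro w a b I hI hb ⟨e, he⟩
      refine ⟨b + p ^ m * (p ^ (r + 1) * e), add_mem hb (I.mul_mem_right _ hI), ?_⟩
      linear_combination he
    refine ⟨y, hy, p ^ m, hpm, le_antisymm ?_ ?_⟩
    · refine Ideal.span_singleton_mul_le_iff.2 fun i hi => ?_
      obtain ⟨b, hb, hb'⟩ := h1 i hi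
      obtain ⟨b', hb1, hb2⟩ := red hJ hb hb'
      rw [hb2]
      exact Ideal.mul_mem_mul (Ideal.mem_span_singleton_self _) hb1
    · refine Ideal.span_singleton_mul_le_iff.2 fun j hj => ?_
      obtain ⟨a, ha, ha'⟩ := h2 j hj
      obtain ⟨a', ha1, ha2⟩ := red hI ha ha'
      refine Ideal.mem_span_singleton_mul.2 ⟨↑u⁻¹ * a', I.mul_mem_left _ ha1, ?_⟩
      rw [← mul_cancel_left_mem_nonZeroDivisors (mul_mem hpm u.isUnit.mem_nonZeroDivisors)]
      have hu' : (u : S) * ↑u⁻¹ = 1 := u.mul_inv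
      rw [two_mul, pow_add] at hyz
      linear_combination p ^ m * y * a' * hu' - y * ha2 + j * hyz

theorem exists_mem_nonZeroDivisors (h : FinitelyComplete p) {I : Ideal S} {n : ℕ}
    (hI : p ^ n ∈ I) : ∃ x ∈ I, x ∈ nonZeroDivisors S := ⟨_, hI, h.pow_mem n⟩

theorem exists_pow_mem (h : FinitelyComplete p) {I : Ideal S}
    (hI : ∃ x ∈ I, x ∈ nonZeroDivisors S) : ∃ n, p ^ n ∈ I := by
  obtain ⟨x, hx, hx'⟩ := hI
  obtain ⟨n, hn⟩ := h.exists_dvd_pow hx'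
  exact ⟨n, I.mem_of_dvd hn hx⟩

/-- A set of ideals that contains the unit class and is closed, up to equivalence, under passage
to the ideals between `p * L` and `L` meets every class. -/
theorem exists_sameClass_of_neighbours {R : Set (Ideal S)}
    (htop : ∃ L ∈ R, SameClass L ⊤)
    (hR : ∀ L ∈ R, ∀ J ≤ L, (∀ a ∈ L, p * a ∈ J) → ∃ L' ∈ R, SameClass L' J)
    {I : Ideal S} {n : ℕ} (hI : p ^ n ∈ I) : ∃ L ∈ R, SameClass L I := by
  -- The chain `I ⊔ (p ^ t)` descends from `⊤` to `I`, and each term contains `p` times its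
  -- predecessor.
  have key : ∀ t, ∃ L ∈ R, SameClass L (I ⊔ Ideal.span {p ^ t}) := by
    intro t
    induction t with
    | zero => simpa using htop
    | succ t ih =>
      obtain ⟨L, hL, a, ha, b, hb, hab⟩ := ih
      set J := I ⊔ Ideal.span {p ^ t}
      set J' := I ⊔ Ideal.span {p ^ (t + 1)}
      have hJ'J : J' ≤ J := sup_le_sup le_rfl
        (Ideal.span_singleton_le_span_singleton.2 (pow_dvd_pow p t.le_succ))
      have hJJ' : ∀ x ∈ J, p * x ∈ J' := by
        intro x hx
        obtain ⟨i, hi, q, hq, rfl⟩ := Submodule.mem_sup.1 hx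
        obtain ⟨c, rfl⟩ := Ideal.mem_span_singleton.1 hq
        rw [mul_add]
        refine add_mem (Ideal.mem_sup_left (I.mul_mem_left _ hi)) (Ideal.mem_sup_right ?_)
        exact Ideal.mem_span_singleton.2 ⟨c, by ring⟩
      -- This is `(b / a) J'`: the equivalence that carries `J` to `L` carries `J'` to a neighbour
      -- of `L`.
      let L₁ : Ideal S := Submodule.comap (LinearMap.mulLeft S a) (Ideal.span {b} * J')
      have hL₁ : ∀ s, s ∈ L₁ ↔ ∃ j ∈ J', b * j = a * s := fun s =>
        Ideal.mem_span_singleton_mul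
      have hbJ : ∀ j ∈ J, ∃ l ∈ L, a * l = b * j := fun j hj => Ideal.mem_span_singleton_mul.1
        (hab.symm ▸ Ideal.mul_mem_mul (Ideal.mem_span_singleton_self _) hj)
      have haL : ∀ l ∈ L, ∃ j ∈ J, b * j = a * l := fun l hl => Ideal.mem_span_singleton_mul.1
        (hab ▸ Ideal.mul_mem_mul (Ideal.mem_span_singleton_self _) hl)
      obtain ⟨L', hL', hs⟩ := hR L hL L₁ (fun s hs => by
          obtain ⟨j, hj, hjs⟩ := (hL₁ s).1 hs
          obtain ⟨l, hl, hlj⟩ := hbJ j (hJ'J hj)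
          rwa [← (mul_cancel_left_mem_nonZeroDivisors ha).1 (hlj.trans hjs)])
        (fun l hl => by
          obtain ⟨j, hj, hjl⟩ := haL l hl
          exact (hL₁ _).2 ⟨p * j, hJJ' j hj, by rw [mul_left_comm, hjl, mul_left_comm]⟩)
      refine ⟨L', hL', hs.trans ⟨a, ha, b, hb, le_antisymm ?_ ?_⟩⟩
      · refine Ideal.span_singleton_mul_le_iff.2 fun s hs => ?_
        exact hs
      · refine Ideal.span_singleton_mul_le_iff.2 fun j hj => ?_
        obtain ⟨l, hl, hlj⟩ := hbJ j (hJ'J hj)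
        exact Ideal.mem_span_singleton_mul.2 ⟨l, (hL₁ l).2 ⟨j, hj, hlj.symm⟩, hlj⟩
  have := key n
  rwa [sup_eq_left.2 (Ideal.span_le.2 (by simpa using hI))] at this

/-- If every class is represented by an ideal that contains `p ^ t`, then there are only finitely
many classes. -/
theorem finite_ICM (h : FinitelyComplete p) {t : ℕ}
    (ht : ∀ (I : Ideal S) (n : ℕ), p ^ n ∈ I → ∃ J, p ^ t ∈ J ∧ SameClass I J) :
    Finite (ICM S) := by
  have hrep : ∀ c : ICM S, ∃ (J : Ideal S) (hJ : p ^ t ∈ J),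
      classOfIdeal J (h.exists_mem_nonZeroDivisors hJ) = c := by
    intro c
    obtain ⟨I, hI, rfl⟩ := exists_classOfIdeal_eq c
    obtain ⟨n, hn⟩ := h.exists_pow_mem hI
    obtain ⟨J, hJ, hIJ⟩ := ht I n hn
    exact ⟨J, hJ, (classOfIdeal_eq_iff _ _).2 hIJ.symm⟩
  choose J hJ hc using hrep
  have := h.finite_quotient t
  -- An ideal that contains `p ^ t` is determined by its image in the finite ring `S / p ^ t`.
  refine Finite.of_injective
    (fun c => ((J c).map (Ideal.Quotient.mk (Ideal.span {p ^ t})) : Set (S ⧸ Ideal.span {p ^ t})))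
    fun c c' hcc => ?_
  have hJJ : J c = J c' := by
    have := congrArg (Ideal.comap (Ideal.Quotient.mk (Ideal.span {p ^ t}))) (SetLike.coe_injective hcc)
    rwa [Ideal.comap_map_of_surjective' _ Ideal.Quotient.mk_surjective,
      Ideal.comap_map_of_surjective' _ Ideal.Quotient.mk_surjective, Ideal.mk_ker,
      sup_eq_left.2 (Ideal.span_le.2 (by simpa using hJ c)),
      sup_eq_left.2 (Ideal.span_le.2 (by simpa using hJ c'))] at this
  rw [← hc c, ← hc c', classOfIdeal_eq_iff, hJJ]
  exact ⟨1, one_mem _, 1, one_mem _, rfl⟩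

end FinitelyComplete

/-! ### The adic completion at a principal ideal -/

section Completion

variable {R : Type*} [CommRing R] {J : Ideal R} {π : R}

/-- For finitely generated `J` the kernel of evaluation at level `n` is `J ^ n` times the
completion. Divisibility in the completion thereby becomes a question in `R / J ^ n`. -/
theorem adicCompletion_pow_dvd_iff (hJ : J = Ideal.span {π}) (n : ℕ) (s : AdicCompletion J R) :
    algebraMap R (AdicCompletion J R) π ^ n ∣ s ↔ AdicCompletion.evalₐ J n s = 0 := by
  have hfg : J.FG := hJ ▸ Submodule.fg_span_singleton π
  have h1 := AdicCompletion.pow_smul_top_eq_ker_eval (M := R) (n := n) hfg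
  have h2 : AdicCompletion.evalₐ J n s = 0 ↔ s ∈ (AdicCompletion.eval J R n).ker := by
    rw [LinearMap.mem_ker]
    have h : (J ^ n • ⊤ : Ideal R) = J ^ n := by ext x; simp
    exact map_eq_zero_iff _ (Ideal.quotientEquivAlgOfEq R h).injective
  rw [h2, ← h1]
  have h3 : J ^ n = Ideal.span {π ^ n} := by rw [hJ, Ideal.span_singleton_pow]
  rw [h3, Submodule.ideal_span_singleton_smul, Submodule.mem_smul_pointwise_iff_exists]
  simp only [Submodule.mem_top, true_and, Algebra.smul_def, map_pow]
  exact ⟨fun ⟨c, hc⟩ => ⟨c, hc.symm⟩, fun ⟨c, hc⟩ => ⟨c, hc.symm⟩⟩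

theorem adicCompletion_exists_pow_dvd_sub (hJ : J = Ideal.span {π}) (n : ℕ)
    (s : AdicCompletion J R) : ∃ r : R,
      algebraMap R (AdicCompletion J R) π ^ n ∣ s - algebraMap R (AdicCompletion J R) r := by
  obtain ⟨r, hr⟩ := Ideal.Quotient.mk_surjective (AdicCompletion.evalₐ J n s)
  refine ⟨r, (adicCompletion_pow_dvd_iff hJ n _).2 ?_⟩
  rw [map_sub, AlgHom.commutes, ← hr, Ideal.Quotient.algebraMap_eq, sub_self]

theorem adicCompletion_pow_dvd_algebraMap_iff (hJ : J = Ideal.span {π}) (n : ℕ) (r : R) :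
    algebraMap R (AdicCompletion J R) π ^ n ∣ algebraMap R (AdicCompletion J R) r ↔ π ^ n ∣ r := by
  rw [adicCompletion_pow_dvd_iff hJ, AlgHom.commutes, Ideal.Quotient.algebraMap_eq,
    Ideal.Quotient.eq_zero_iff_mem, hJ, Ideal.span_singleton_pow, Ideal.mem_span_singleton]

theorem adicCompletion_finitelyComplete (hJ : J = Ideal.span {π}) (hπ : π ∈ nonZeroDivisors R)
    (hfin : ∀ n, Finite (R ⧸ Ideal.span {π ^ n})) :
    FinitelyComplete (algebraMap R (AdicCompletion J R) π) := by
  have hfg : J.FG := hJ ▸ Submodule.fg_span_singleton π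
  refine ⟨?_, fun n => ?_, ?_⟩
  · rw [mem_nonZeroDivisors_iff_right]
    intro s hs
    refine AdicCompletion.ext_evalₐ fun n => ?_
    rw [map_zero, ← adicCompletion_pow_dvd_iff hJ]
    -- Cancelling `π` costs one power, hence precision `n + 1` to control `s` modulo `π ^ n`.
    obtain ⟨r, c, hc⟩ := adicCompletion_exists_pow_dvd_sub hJ (n + 1) s
    have h1 : π ^ (n + 1) ∣ π * r := by
      rw [← adicCompletion_pow_dvd_algebraMap_iff hJ, map_mul]
      exact ⟨- algebraMap R _ π * c, by linear_combination hs - algebraMap R _ π * hc⟩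
    obtain ⟨d, hd⟩ := h1
    have h2 : r = π ^ n * d := by
      rw [← mul_cancel_left_mem_nonZeroDivisors hπ, hd]
      ring
    rw [h2, map_mul, map_pow] at hc
    exact ⟨algebraMap R _ d + algebraMap R _ π * c, by linear_combination hc⟩
  · have := hfin n
    have hsurj : ∀ q : AdicCompletion J R ⧸ Ideal.span {algebraMap R (AdicCompletion J R) π ^ n},
        ∃ r : R, Ideal.Quotient.mk _ (algebraMap R _ r) = q := by
      intro q
      obtain ⟨s, rfl⟩ := Ideal.Quotient.mk_surjective q
      obtain ⟨r, hr⟩ := adicCompletion_exists_pow_dvd_sub hJ n s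
      refine ⟨r, ?_⟩
      rw [eq_comm, Ideal.Quotient.eq, Ideal.mem_span_singleton]
      exact hr
    choose r hr using hsurj
    refine Finite.of_injective (fun q => Ideal.Quotient.mk (Ideal.span {π ^ n}) (r q))
      fun q q' hq => ?_
    simp only [Ideal.Quotient.eq, Ideal.mem_span_singleton] at hq
    rw [← hr q, ← hr q', Ideal.Quotient.eq, Ideal.mem_span_singleton, ← map_sub]
    exact (adicCompletion_pow_dvd_algebraMap_iff hJ n _).2 hq
  · have := AdicCompletion.isAdicComplete (M := R) hfg
    have h1 : Ideal.span {algebraMap R (AdicCompletion J R) π} =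
        J.map (algebraMap R (AdicCompletion J R)) := by
      rw [hJ, Ideal.map_span, Set.image_singleton]
    rw [h1]
    exact (IsAdicComplete.map_algebraMap_iff _ _).2 this

end Completion

/-! ### A common power of the prime in representatives of all classes -/

section Conductor

variable {R O : Type*} [CommRing R] [CommRing O] [Algebra R O]

/-- For an extension `O` of `R` with `D * O ⊆ R`, the ideal `D * O` of `R`. -/
def multiplesIdeal (O : Type*) [CommRing O] [Algebra R O] (D : R) : Ideal R :=
  (Ideal.span {algebraMap R O D}).comap (algebraMap R O)

/-- Since `D * O` is an `O`-module inside `R`, multiplying by it turns `X` into its extension to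
`O`. Identities between ideals of `O` thus descend to `R`. -/
theorem mul_multiplesIdeal (hinj : Function.Injective (algebraMap R O)) {D : R}
    (hD : ∀ o : O, ∃ r, algebraMap R O r = algebraMap R O D * o) (X : Ideal R) :
    X * multiplesIdeal O D =
      (Ideal.span {algebraMap R O D} * X.map (algebraMap R O)).comap (algebraMap R O) := by
  refine le_antisymm (Ideal.mul_le.2 fun x hx r hr => ?_) fun r hr => ?_
  · obtain ⟨q, hq⟩ := Ideal.mem_span_singleton.1 (Ideal.mem_comap.1 hr)
    rw [Ideal.mem_comap, map_mul, hq, mul_left_comm, mul_comm _ q]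
    exact Ideal.mul_mem_mul (Ideal.mem_span_singleton_self _)
      (Ideal.mul_mem_left _ _ (Ideal.mem_map_of_mem _ hx))
  · obtain ⟨w, hw, hwr⟩ := Ideal.mem_span_singleton_mul.1 (Ideal.mem_comap.1 hr)
    -- The extra factor `q` makes the claim stable under multiplication by `O`, as the span
    -- induction requires.
    have key : ∀ w ∈ X.map (algebraMap R O), ∀ q : O, ∃ r ∈ X * multiplesIdeal O D,
        algebraMap R O r = algebraMap R O D * (q * w) := by
      intro w hw
      refine Submodule.span_induction (p := fun w _ => ∀ q : O, ∃ r ∈ X * multiplesIdeal O D,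
        algebraMap R O r = algebraMap R O D * (q * w)) ?_ ?_ ?_ ?_ hw
      · rintro _ ⟨x, hx, rfl⟩ q
        obtain ⟨r, hr⟩ := hD q
        refine ⟨x * r, Ideal.mul_mem_mul hx ?_, ?_⟩
        · exact Ideal.mem_comap.2 (Ideal.mem_span_singleton.2 ⟨q, hr⟩)
        · rw [map_mul, hr]; ring
      · exact fun q => ⟨0, zero_mem _, by simp⟩
      · intro u v _ _ hu hv q
        obtain ⟨r, hr, hr'⟩ := hu q
        obtain ⟨s, hs, hs'⟩ := hv q
        exact ⟨r + s, add_mem hr hs, by rw [map_add, hr', hs']; ring⟩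
      · intro a u _ hu q
        obtain ⟨r, hr, hr'⟩ := hu (q * a)
        exact ⟨r, hr, by rw [hr', smul_eq_mul, mul_assoc]⟩
    obtain ⟨r', hr', he⟩ := key w hw 1
    rw [one_mul, hwr] at he
    rwa [← hinj he]

/-- In a Dedekind domain the extension of `I` is generated by `t` and one further element. The
factor `D` brings that element into `R`. -/
theorem exists_mul_multiplesIdeal_eq [IsDedekindDomain O]
    (hinj : Function.Injective (algebraMap R O)) {D : R}
    (hD : ∀ o : O, ∃ r, algebraMap R O r = algebraMap R O D * o)
    (I : Ideal R) {t : R} (ht : t ∈ I) (ht0 : t ≠ 0) :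
    ∃ a, Ideal.span {D} * I * multiplesIdeal O D =
      (Ideal.span {a} ⊔ Ideal.span {D * t}) * multiplesIdeal O D := by
  have h1 : Ideal.span {algebraMap R O t} ≤ I.map (algebraMap R O) :=
    (Ideal.span_singleton_le_iff_mem _).2 (Ideal.mem_map_of_mem _ ht)
  have h2 : Ideal.span {algebraMap R O t} ≠ 0 := by
    rw [Ne, Ideal.zero_eq_bot, Ideal.span_singleton_eq_bot]
    exact fun h => ht0 (hinj (by rw [h, map_zero]))
  obtain ⟨a, ha⟩ := IsDedekindDomain.exists_sup_span_eq h1 h2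
  obtain ⟨b, hb⟩ := hD a
  refine ⟨b, ?_⟩
  rw [mul_multiplesIdeal hinj hD, mul_multiplesIdeal hinj hD, Ideal.map_mul, Ideal.map_sup, ← ha]
  simp only [Ideal.map_span, Set.image_singleton, map_mul, hb]
  simp only [← Ideal.span_singleton_mul_span_singleton, ← Ideal.mul_sup]
  rw [sup_comm]

end Conductor

namespace FinitelyComplete

variable {S : Type*} [CommRing S] {p : S}

/-- Since `p ^ n ∈ I`, the summand with `p ^ (n + 1)` lies in `p` times the left side, and
Nakayama's lemma gives `d I C = a C`. Put `L = a⁻¹ d² I`. It is integral, because `d ∈ C` implies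
`d² I ⊆ d I C = a C`. Moreover `L C = d C`, so `d² ∈ L C ⊆ L`. -/
theorem exists_sameClass_of_mul_eq (h : FinitelyComplete p) {I C : Ideal S} (hI : I.FG)
    (hC : C.FG) {d a : S} {m n : ℕ} (hd : d ∣ p ^ m) (hdC : d ∈ C) (hn : p ^ n ∈ I)
    (ha : Ideal.span {d} * I * C = (Ideal.span {a} ⊔ Ideal.span {d * p ^ (n + 1)}) * C) :
    ∃ L, p ^ (2 * m) ∈ L ∧ SameClass I L := by
  have hdnz : d ∈ nonZeroDivisors S := by
    obtain ⟨c, hc⟩ := hd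
    exact (mul_mem_nonZeroDivisors.1 (hc ▸ h.pow_mem m)).1
  rw [Ideal.sup_mul] at ha
  have hle : Ideal.span {d * p ^ (n + 1)} * C ≤ Ideal.span {p} * (Ideal.span {d} * I * C) := by
    rw [pow_succ', mul_left_comm, ← Ideal.span_singleton_mul_span_singleton, mul_assoc,
      ← Ideal.span_singleton_mul_span_singleton, mul_assoc]
    refine Ideal.mul_mono_right ?_
    rw [mul_assoc]
    refine Ideal.mul_mono_right (Ideal.mul_mono_left ?_)
    exact (Ideal.span_singleton_le_iff_mem _).2 hn
  have hQ : Ideal.span {d} * I * C = Ideal.span {a} * C := by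
    refine le_antisymm ?_ (ha ▸ le_sup_left)
    have hfg : (Ideal.span {d} * I * C).FG :=
      Submodule.FG.mul (Submodule.FG.mul (Submodule.fg_span_singleton _) hI) hC
    refine Submodule.le_of_le_smul_of_le_jacobson_bot (I := Ideal.span {p}) hfg ?_ ?_
    · have := h.complete
      exact IsAdicComplete.le_jacobson_bot _
    · conv_lhs => rw [ha]
      exact sup_le_sup le_rfl hle
  have hanz : a ∈ nonZeroDivisors S := by
    have : d * p ^ n * d ∈ Ideal.span {d} * I * C :=
      Ideal.mul_mem_mul (Ideal.mul_mem_mul (Ideal.mem_span_singleton_self _) hn) hdC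
    rw [hQ] at this
    obtain ⟨c, _, hc⟩ := Ideal.mem_span_singleton_mul.1 this
    have h2 : d * p ^ n * d ∈ nonZeroDivisors S := mul_mem (mul_mem hdnz (h.pow_mem n)) hdnz
    exact (mul_mem_nonZeroDivisors.1 (hc ▸ h2)).1
  let L : Ideal S := Submodule.comap (LinearMap.mulLeft _ a) (Ideal.span {d * d} * I)
  have hL : Ideal.span {a} * L = Ideal.span {d * d} * I := by
    refine le_antisymm (Ideal.span_singleton_mul_le_iff.2 fun s hs => hs)
      (Ideal.span_singleton_mul_le_iff.2 fun i hi => ?_)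
    have : d * d * i ∈ Ideal.span {a} * C := by
      rw [← hQ, mul_right_comm d d i]
      exact Ideal.mul_mem_mul (Ideal.mul_mem_mul (Ideal.mem_span_singleton_self _) hi) hdC
    obtain ⟨c, _, hc⟩ := Ideal.mem_span_singleton_mul.1 this
    refine Ideal.mem_span_singleton_mul.2 ⟨c, ?_, hc⟩
    change a * c ∈ Ideal.span {d * d} * I
    rw [hc]
    exact Ideal.mul_mem_mul (Ideal.mem_span_singleton_self _) hi
  refine ⟨L, ?_, _, mul_mem hdnz hdnz, _, hanz, hL.symm⟩
  have hLC : Ideal.span {a} * (L * C) = Ideal.span {a} * (Ideal.span {d} * C) := by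
    rw [← mul_assoc, hL, ← Ideal.span_singleton_mul_span_singleton, mul_assoc, mul_assoc,
      ← mul_assoc _ I C, hQ, mul_left_comm]
  have hdd : d * d ∈ L := by
    have h1 : a * (d * d) ∈ Ideal.span {a} * (L * C) := hLC ▸ Ideal.mul_mem_mul
      (Ideal.mem_span_singleton_self _) (Ideal.mul_mem_mul (Ideal.mem_span_singleton_self _) hdC)
    obtain ⟨c, hc, hc'⟩ := Ideal.mem_span_singleton_mul.1 h1
    rw [← (mul_cancel_left_mem_nonZeroDivisors hanz).1 hc']
    exact Ideal.mul_le_left (I := L) (J := C) hc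
  refine L.mem_of_dvd ?_ hdd
  rw [two_mul, pow_add]
  exact mul_dvd_mul hd hd

end FinitelyComplete

section Bound

variable {R : Type*} [CommRing R] {J : Ideal R} {π : R}

/-- Elements of the completion agree with elements of `R` modulo `π ^ n`, and the error already lies
in the ideal. -/
theorem adicCompletion_exists_map_eq (hJ : J = Ideal.span {π}) {I : Ideal (AdicCompletion J R)}
    {n : ℕ} (hI : algebraMap R (AdicCompletion J R) π ^ n ∈ I) :
    ∃ I₀ : Ideal R, I₀.map (algebraMap R (AdicCompletion J R)) = I ∧ π ^ n ∈ I₀ := by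
  set φ := algebraMap R (AdicCompletion J R)
  have hmem : π ^ n ∈ I.comap φ := by rwa [Ideal.mem_comap, map_pow]
  refine ⟨I.comap φ, le_antisymm Ideal.map_comap_le fun s hs => ?_, hmem⟩
  obtain ⟨r, c, hc⟩ := adicCompletion_exists_pow_dvd_sub hJ n s
  have hpn : φ π ^ n ∈ (I.comap φ).map φ := by
    rw [← map_pow]
    exact Ideal.mem_map_of_mem _ hmem
  have hsr : s = φ r + φ π ^ n * c := by linear_combination hc
  have hrs : φ r = s - φ π ^ n * c := by linear_combination -hc
  rw [hsr]
  refine add_mem (Ideal.mem_map_of_mem _ (Ideal.mem_comap.2 ?_)) (Ideal.mul_mem_right _ _ hpn)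
  rw [hrs]
  exact sub_mem hs (I.mul_mem_right _ hI)

/-- If `R` has an overring `O` with `D * O ⊆ R` which is a Dedekind domain, then there is a common
power of `π` in suitable representatives of all ideal classes of the completion of `R` at `π`. -/
theorem exists_pow_mem_of_multiples [IsDomain R] [IsNoetherianRing R] (O : Type*) [CommRing O]
    [Algebra R O] [IsDedekindDomain O] (hJ : J = Ideal.span {π}) (hπ : π ≠ 0)
    (hS : FinitelyComplete (algebraMap R (AdicCompletion J R) π))
    (hinj : Function.Injective (algebraMap R O)) {D : R}
    (hD : ∀ o : O, ∃ r, algebraMap R O r = algebraMap R O D * o) {m : ℕ}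
    (hDm : algebraMap R (AdicCompletion J R) D ∣ algebraMap R (AdicCompletion J R) π ^ m)
    (I : Ideal (AdicCompletion J R)) (n : ℕ) (hI : algebraMap R (AdicCompletion J R) π ^ n ∈ I) :
    ∃ L, algebraMap R (AdicCompletion J R) π ^ (2 * m) ∈ L ∧ SameClass I L := by
  obtain ⟨I₀, rfl, hI₀⟩ := adicCompletion_exists_map_eq hJ hI
  -- The exponent is `n + 1` and not `n`: the spare factor `π` is what Nakayama's lemma consumes.
  obtain ⟨a, ha⟩ := exists_mul_multiplesIdeal_eq hinj hD I₀
    (t := π ^ (n + 1)) (I₀.mem_of_dvd (pow_dvd_pow π n.le_succ) hI₀) (pow_ne_zero _ hπ)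
  have hDC : D ∈ multiplesIdeal O D := Ideal.mem_comap.2 (Ideal.mem_span_singleton_self _)
  have ha' := congrArg (Ideal.map (algebraMap R (AdicCompletion J R))) ha
  simp only [Ideal.map_mul, Ideal.map_sup, Ideal.map_span, Set.image_singleton, map_mul,
    map_pow] at ha'
  exact hS.exists_sameClass_of_mul_eq
    (Ideal.FG.map (IsNoetherian.noetherian I₀) _) (Ideal.FG.map (IsNoetherian.noetherian _) _)
    hDm (Ideal.mem_map_of_mem _ hDC) hI ha'

end Bound

/-! ### Finiteness of the normalization of a plane curve over a finite field -/

section SeparableGenerator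

variable {B R : Type*} [CommRing B] [IsDedekindDomain B] [CommRing R] [IsDomain R]

theorem isSeparable_of_eval_derivative_ne_zero {F K : Type*} [Field F] [Field K] [Algebra F K]
    {x : K} {g : F[X]} (hg : Polynomial.aeval x g = 0)
    (hg' : Polynomial.aeval x (Polynomial.derivative g) ≠ 0) (hx : IsIntegral F x) :
    IsSeparable F x := by
  obtain ⟨h, rfl⟩ := minpoly.dvd F x hg
  rw [Polynomial.derivative_mul, map_add, map_mul, map_mul, minpoly.aeval, zero_mul,
    add_zero] at hg'
  refine (Polynomial.separable_iff_derivative_ne_zero (minpoly.irreducible hx)).2 fun h0 => ?_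
  simp [h0] at hg'

/-- If `R` is generated over a Dedekind domain by one element that is a simple root of a monic
polynomial, then the normalization of `R` is a Dedekind domain and finite over `R`. -/
theorem normalization_finite_of_simple_root (j : B →+* R) (hj : Function.Injective j) (θ : R)
    (hgen : ∀ r, ∃ g : B[X], g.eval₂ j θ = r) {F : B[X]} (hF : F.Monic) (h0 : F.eval₂ j θ = 0)
    (h1 : (Polynomial.derivative F).eval₂ j θ ≠ 0) :
    IsDedekindDomain (integralClosure R (FractionRing R)) ∧
      Module.Finite R (integralClosure R (FractionRing R)) := by
  let : Algebra B R := j.toAlgebra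
  have hθ : IsIntegral B θ := ⟨F, hF, h0⟩
  have hadj : Algebra.adjoin B {θ} = ⊤ := by
    refine eq_top_iff.2 fun r _ => ?_
    obtain ⟨g, rfl⟩ := hgen r
    exact Algebra.adjoin_singleton_eq_range_aeval B θ ▸ ⟨g, rfl⟩
  have : Module.Finite B R := by
    have := hθ.fg_adjoin_singleton
    rw [hadj] at this
    exact ⟨this⟩
  have : FaithfulSMul B R := (faithfulSMul_iff_algebraMap_injective B R).2 hj
  have : FaithfulSMul B (FractionRing R) := by
    rw [faithfulSMul_iff_algebraMap_injective, IsScalarTower.algebraMap_eq B R]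
    exact (IsFractionRing.injective R _).comp hj
  let := FractionRing.liftAlgebra B (FractionRing R)
  have := FractionRing.isScalarTower_liftAlgebra B (FractionRing R)
  have : FiniteDimensional (FractionRing B) (FractionRing R) :=
    .of_isLocalization B R (nonZeroDivisors B)
  let x : FractionRing R := algebraMap R _ θ
  have hmap : ∀ g : B[X], Polynomial.aeval x (g.map (algebraMap B (FractionRing B))) =
      algebraMap R (FractionRing R) (g.eval₂ j θ) := by
    intro g
    rw [Polynomial.aeval_map_algebraMap, Polynomial.aeval_algebraMap_apply]
    rfl
  have hxs : IsSeparable (FractionRing B) x := by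
    refine isSeparable_of_eval_derivative_ne_zero (g := F.map (algebraMap B (FractionRing B))) ?_ ?_
      (Algebra.IsIntegral.isIntegral x)
    · rw [hmap, h0, map_zero]
    · rw [Polynomial.derivative_map, hmap]
      exact fun h => h1 (IsFractionRing.injective R (FractionRing R) (h.trans (map_zero _).symm))
  have htop : IntermediateField.adjoin (FractionRing B) {x} = ⊤ := by
    refine eq_top_iff.2 fun y _ => ?_
    have hR : ∀ r : R, algebraMap R (FractionRing R) r ∈
        IntermediateField.adjoin (FractionRing B) {x} := by
      intro r
      obtain ⟨g, rfl⟩ := hgen r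
      rw [← hmap]
      exact IntermediateField.algebra_adjoin_le_adjoin _ _
        (Algebra.adjoin_singleton_eq_range_aeval (FractionRing B) x ▸ ⟨_, rfl⟩)
    obtain ⟨a, b, hb, rfl⟩ := IsFractionRing.div_surjective (A := R) y
    exact div_mem (hR a) (hR b)
  have : Algebra.IsSeparable (FractionRing B) (FractionRing R) := by
    have := (IntermediateField.isSeparable_adjoin_simple_iff_isSeparable
      (FractionRing B) (FractionRing R)).2 hxs
    rw [htop] at this
    exact AlgEquiv.Algebra.isSeparable
      (IntermediateField.topEquiv (F := FractionRing B) (E := FractionRing R))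
  have : Algebra.IsIntegral B R := inferInstance
  have : IsIntegralClosure (integralClosure R (FractionRing R)) B (FractionRing R) := by
    refine ⟨Subtype.val_injective, fun {y} => ⟨fun hy => ⟨⟨y, hy.tower_top⟩, rfl⟩, ?_⟩⟩
    rintro ⟨z, rfl⟩
    exact isIntegral_trans (R := B) (A := R) _ z.2
  have hfin := IsIntegralClosure.finite B (FractionRing B) (FractionRing R)
    (integralClosure R (FractionRing R))
  exact ⟨IsIntegralClosure.isDedekindDomain B (FractionRing B) (FractionRing R) _,
    Module.Finite.of_restrictScalars_finite B R _⟩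

end SeparableGenerator

open Polynomial

section Normalization

variable {k : Type*} [Field k]

/-- The derivative with respect to the variable of the coefficients. -/
noncomputable def innerDerivative (f : k[X][X]) : k[X][X] :=
  ∑ i ∈ Finset.range (f.natDegree + 1), monomial i (derivative (f.coeff i))

theorem coeff_innerDerivative (f : k[X][X]) (i : ℕ) :
    (innerDerivative f).coeff i = derivative (f.coeff i) := by
  rw [innerDerivative, finsetSum_coeff]
  simp only [coeff_monomial, Finset.sum_ite_eq', Finset.mem_range, Order.lt_add_one_iff]
  split_ifs with h
  · rfl
  · rw [coeff_eq_zero_of_natDegree_lt (by lia), derivative_zero]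

theorem innerDerivative_add (f g : k[X][X]) :
    innerDerivative (f + g) = innerDerivative f + innerDerivative g := by
  ext1 i
  simp [coeff_innerDerivative]

theorem innerDerivative_monomial (n : ℕ) (a : k[X]) :
    innerDerivative (monomial n a) = monomial n (derivative a) := by
  ext1 i
  rw [coeff_innerDerivative, coeff_monomial, coeff_monomial]
  split_ifs <;> simp

/-- Over a perfect field a polynomial with vanishing partial derivatives is a `p`-th power. -/
theorem innerDerivative_ne_zero [Finite k] {f : k[X][X]} (hf : Irreducible f)
    (h0 : derivative f = 0) : innerDerivative f ≠ 0 := by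
  intro h1
  obtain ⟨p, hp⟩ := CharP.exists k
  have hpp : p.Prime := (CharP.char_is_prime_or_zero k p).resolve_right
    fun h => by subst h; exact CharP.char_ne_zero_of_finite k 0 rfl
  have := Fact.mk hpp
  have : PerfectRing k p := inferInstance
  -- A polynomial with zero derivative is a polynomial in the `p`-th power of the variable, and over
  -- the perfect field `k` its coefficients are `p`-th powers. The same argument is then repeated in
  -- the outer variable.
  have hc : ∀ c : k[X], derivative c = 0 → ∃ d : k[X], d ^ p = c := by
    intro c hc
    rw [← expand_contract p hc hpp.ne_zero, polynomial_expand_eq]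
    exact ⟨_, rfl⟩
  have hc' : ∀ i, ∃ d : k[X], d ^ p = (contract p f).coeff i := by
    intro i
    refine hc _ ?_
    rw [coeff_contract hpp.ne_zero, ← coeff_innerDerivative, h1, coeff_zero]
  choose d hd using hc'
  let G : k[X][X] := ∑ i ∈ Finset.range ((contract p f).natDegree + 1), monomial i (d i)
  have hG : G.map (frobenius k[X] p) = contract p f := by
    rw [Polynomial.map_sum]
    simp only [map_monomial, frobenius_def, hd]
    exact ((contract p f).as_sum_range).symm
  have hfG : f = G ^ p := by
    rw [← expand_contract p h0 hpp.ne_zero, ← hG, ← map_expand, map_frobenius_expand]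
  rw [hfG] at hf
  exact absurd hf (not_irreducible_pow hpp.ne_one)

/-- The substitution `T ↦ X`, `x ↦ Y + X ^ N`. -/
noncomputable def shear (k : Type*) [Field k] (N : ℕ) : k[X][X] →+* k[X][X] :=
  eval₂RingHom (eval₂RingHom (C.comp C) X) (C X + X ^ N)

/-- The chain rule: the shear makes `T` the outer variable, on which the image of `x` also depends.
If the derivative in `x` vanishes, only the derivative in `T` remains. -/
theorem derivative_shear (N : ℕ) (f : k[X][X]) :
    derivative (shear k N f) = shear k N (innerDerivative f) +
      shear k N (derivative f) * derivative (C X + X ^ N) := by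
  have hcoef : ∀ a : k[X], derivative (eval₂ (C.comp C : k →+* k[X][X]) X a) =
      eval₂ (C.comp C) X (derivative a) := by
    intro a
    induction a using Polynomial.induction_on' with
    | add a b ha hb => simp only [eval₂_add, derivative_add, ha, hb]
    | monomial n a =>
      simp only [eval₂_monomial, derivative_monomial, RingHom.comp_apply, derivative_C_mul,
        derivative_X_pow, map_mul, map_natCast]
      ring
  induction f using Polynomial.induction_on' with
  | add f g hf hg =>
    generalize derivative (C X + X ^ N : k[X][X]) = c at hf hg ⊢
    simp only [map_add, hf, hg, innerDerivative_add]
    ring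
  | monomial n a =>
    rw [innerDerivative_monomial, derivative_monomial]
    simp only [shear, coe_eval₂RingHom, eval₂_monomial, derivative_mul, hcoef, derivative_pow,
      map_mul, map_natCast]
    ring

/-- The leading term becomes `(Y + X ^ N) ^ d`, of degree `d * N`. A term with exponent `i < d` has
degree less than `N + i * N ≤ d * N`. -/
theorem shear_monic {f : k[X][X]} (hf : f.Monic) {N : ℕ} (hN : ∀ i, (f.coeff i).natDegree < N) :
    (shear k N f).Monic := by
  have hN0 : 0 < N := (Nat.zero_le _).trans_lt (hN 0)
  have hY : (C X + X ^ N : k[X][X]).Monic := by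
    rw [add_comm]
    exact monic_X_pow_add_C _ hN0.ne'
  have hYd : (C X + X ^ N : k[X][X]).natDegree = N := by
    rw [add_comm]
    exact natDegree_X_pow_add_C
  have hsum : shear k N f = (C X + X ^ N) ^ f.natDegree + ∑ i ∈ Finset.range f.natDegree,
      eval₂ (C.comp C : k →+* k[X][X]) X (f.coeff i) * (C X + X ^ N) ^ i := by
    rw [shear, coe_eval₂RingHom, eval₂_eq_sum_range, Finset.sum_range_succ, add_comm,
      hf.coeff_natDegree, map_one, one_mul]
    rfl
  rw [hsum]
  refine Monic.add_of_left (hY.pow _) (lt_of_lt_of_le ?_ (degree_eq_natDegree (hY.pow _).ne_zero).ge)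
  rw [hY.natDegree_pow, hYd]
  refine (degree_sum_le _ _).trans_lt ((Finset.sup_lt_iff (WithBot.bot_lt_coe _)).2 fun i hi => ?_)
  have h1 : (eval₂ (C.comp C : k →+* k[X][X]) X (f.coeff i)).natDegree ≤ (f.coeff i).natDegree := by
    have : eval₂ (C.comp C : k →+* k[X][X]) X (f.coeff i) = (f.coeff i).map C := rfl
    rw [this]
    exact natDegree_map_le
  refine lt_of_le_of_lt degree_le_natDegree (Nat.cast_lt.2 ?_)
  refine natDegree_mul_le.trans_lt ?_
  rw [hY.natDegree_pow, hYd]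
  have h2 := hN i
  have h3 : (i + 1) * N ≤ f.natDegree * N := Nat.mul_le_mul_right _ (Finset.mem_range.1 hi)
  nlinarith

theorem isIntegral_of_generator {B R : Type*} [CommRing B] [CommRing R] (j : B →+* R) (θ : R)
    (hgen : ∀ r, ∃ g : B[X], g.eval₂ j θ = r) {F : B[X]} (hF : F.Monic) (h0 : F.eval₂ j θ = 0) :
    j.IsIntegral := by
  let := j.toAlgebra
  have hθ : IsIntegral B θ := ⟨F, hF, h0⟩
  intro r
  obtain ⟨g, rfl⟩ := hgen r
  exact adjoin_le_integralClosure hθ (Algebra.adjoin_singleton_eq_range_aeval B θ ▸ ⟨g, rfl⟩)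

variable {R : Type*} [CommRing R]

theorem injective_comp_C_of_ker {f : k[X][X]} (hd : 0 < f.natDegree)
    {q : k[X][X] →+* R} (hker : RingHom.ker q = Ideal.span {f}) :
    Function.Injective (q.comp C) := by
  rw [injective_iff_map_eq_zero]
  intro a ha
  have : C a ∈ RingHom.ker q := ha
  rw [hker, Ideal.mem_span_singleton] at this
  by_contra h0
  have := natDegree_le_of_dvd this (by simpa using h0)
  simp at this
  lia

/-- The normalization of an affine plane curve over a finite field is a Dedekind domain and finite
over the coordinate ring of the curve. -/
theorem normalization_finite [IsDomain R] [Finite k] {f : k[X][X]} (hf : f.Monic) (hirr : Irreducible f)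
    (q : k[X][X] →+* R) (hq : Function.Surjective q) (hker : RingHom.ker q = Ideal.span {f}) :
    IsDedekindDomain (integralClosure R (FractionRing R)) ∧
      Module.Finite R (integralClosure R (FractionRing R)) := by
  have hd : 0 < f.natDegree := by
    by_contra! h
    exact hirr.not_isUnit (by
      rw [eq_one_of_monic_natDegree_zero hf (by lia)]
      exact isUnit_one)
  have hq0 : q f = 0 := by
    rw [← RingHom.mem_ker, hker]
    exact Ideal.mem_span_singleton_self f
  have hqne : ∀ g : k[X][X], g ≠ 0 → g.natDegree < f.natDegree → q g ≠ 0 := by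
    intro g hg hgd h
    rw [← RingHom.mem_ker, hker, Ideal.mem_span_singleton] at h
    exact absurd (natDegree_le_of_dvd h hg) (by lia)
  have heval : ∀ g, g.eval₂ (q.comp C) (q X) = q g := fun g => by
    rw [← hom_eval₂, eval₂_C_X]
  have hgen : ∀ r, ∃ g : k[X][X], g.eval₂ (q.comp C) (q X) = r := fun r =>
    (hq r).imp fun g hg => (heval g).trans hg
  have hinj := injective_comp_C_of_ker hd hker
  -- If the derivative is nonzero, `x` is a simple root of `f` over `k[T]`. Otherwise `T` serves as
  -- the generator, over the base `k[x - T ^ N]`.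
  by_cases h0 : derivative f = 0
  swap
  · refine normalization_finite_of_simple_root (q.comp C) hinj (q X) (F := f) hgen hf ?_ ?_
    · rw [heval, hq0]
    · rw [heval]
      exact hqne _ h0 (natDegree_derivative_lt hd.ne')
  · obtain ⟨N, hN⟩ : ∃ N, ∀ i, (f.coeff i).natDegree < N := by
      refine ⟨(Finset.range (f.natDegree + 1)).sup (fun i => (f.coeff i).natDegree) + 1,
        fun i => Nat.lt_succ_of_le ?_⟩
      by_cases hi : i ≤ f.natDegree
      · exact Finset.le_sup (f := fun i => (f.coeff i).natDegree) (Finset.mem_range.2 (by lia))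
      · rw [coeff_eq_zero_of_natDegree_lt (by lia), natDegree_zero]
        exact Nat.zero_le _
    let j : k[X] →+* R := eval₂RingHom (q.comp (C.comp C)) (q (X - C X ^ N))
    have hcomp : ∀ g, (shear k N g).eval₂ j (q (C X)) = q g := by
      intro g
      have : (eval₂RingHom j (q (C X))).comp (shear k N) = q := by
        ext <;> simp [j, shear]
      exact congrArg (fun h : k[X][X] →+* R => h g) this
    have hgenj : ∀ r, ∃ g : k[X][X], g.eval₂ j (q (C X)) = r := fun r => by
      obtain ⟨g, rfl⟩ := hq r
      exact ⟨_, hcomp g⟩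
    have hF0 : (shear k N f).eval₂ j (q (C X)) = 0 := by rw [hcomp, hq0]
    have hmon := shear_monic hf hN
    -- With a nonzero, hence maximal, kernel, `R` would be integral over a field and thus a field.
    -- As `R` is also integral over `k[T]`, this would make `k[T]` a field.
    have hj : Function.Injective j := by
      rw [RingHom.injective_iff_ker_eq_bot]
      by_contra hne
      have hprime : (RingHom.ker j).IsPrime := RingHom.ker_isPrime j
      have hmax : (RingHom.ker j).IsMaximal := hprime.isMaximal hne
      let : Algebra (k[X] ⧸ RingHom.ker j) R := (RingHom.kerLift j).toAlgebra
      have : Algebra.IsIntegral (k[X] ⧸ RingHom.ker j) R := ⟨by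
        have := isIntegral_of_generator j _ hgenj hmon hF0
        refine RingHom.IsIntegral.tower_top (Ideal.Quotient.mk (RingHom.ker j)) (RingHom.kerLift j) ?_
        exact this⟩
      have hR : IsField R := isField_of_isIntegral_of_isField'
        (R := k[X] ⧸ RingHom.ker j) ((Ideal.Quotient.maximal_ideal_iff_isField_quotient _).1 hmax)
      let : Algebra k[X] R := (q.comp C).toAlgebra
      have : Algebra.IsIntegral k[X] R :=
        ⟨isIntegral_of_generator (q.comp C) _ hgen hf (by rw [heval, hq0])⟩
      exact Polynomial.not_isField k (isField_of_isIntegral_of_isField (R := k[X]) hinj hR)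
    refine normalization_finite_of_simple_root j hj (q (C X)) hgenj hmon hF0 ?_
    rw [derivative_shear, h0, map_zero, zero_mul, add_zero, hcomp]
    -- The leading coefficient `1` has derivative zero, so the degree drops below that of `f` and
    -- the class in `R` is nonzero.
    refine hqne _ (innerDerivative_ne_zero hirr h0) ?_
    rw [← Nat.le_sub_one_iff_lt hd, natDegree_le_iff_coeff_eq_zero]
    intro i hi
    rw [coeff_innerDerivative]
    rcases eq_or_lt_of_le (show f.natDegree ≤ i by lia) with rfl | h
    · rw [hf.coeff_natDegree, derivative_one]
    · rw [coeff_eq_zero_of_natDegree_lt h, derivative_zero]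

end Normalization

/-! ### Coefficient lists and normal forms modulo `(f, Q)` -/

section Lists

variable {S : Type*} [Semiring S]

theorem coeff_ofCoeffs (l : List S) (i : ℕ) : (ofCoeffs l).coeff i = l.getD i 0 := by
  induction l generalizing i with
  | nil => simp [ofCoeffs]
  | cons a l ih =>
    cases i with
    | zero => simp [ofCoeffs]
    | succ i => simp [ofCoeffs, ih]

theorem degree_ofCoeffs_lt {l : List S} {n : ℕ} (h : l.length ≤ n) : (ofCoeffs l).degree < n := by
  rw [degree_lt_iff_coeff_zero]
  intro i hi
  rw [coeff_ofCoeffs, List.getD_eq_default _ _ (h.trans hi)]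

theorem ofCoeffs_map_range {a : S[X]} {n : ℕ} (h : a.degree < n) :
    ofCoeffs ((List.range n).map a.coeff) = a := by
  ext i
  rw [coeff_ofCoeffs]
  by_cases hi : i < n
  · simp [List.getD_eq_getElem?_getD, hi]
  · rw [List.getD_eq_default _ _ (by simpa using hi)]
    exact (degree_lt_iff_coeff_zero a n).1 h i (by lia) |>.symm

end Lists

section Reduced

variable {κ : Type*}

/-- The lists of at most `n` lists of length at most `M`. -/
def IsReduced (n M : ℕ) (l : List (List κ)) : Prop :=
  l.length ≤ n ∧ ∀ c ∈ l, c.length ≤ M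

theorem finite_isReduced [Finite κ] (n M : ℕ) : {l : List (List κ) | IsReduced n M l}.Finite := by
  have h1 : {c : List κ | c.length ≤ M}.Finite := List.finite_length_le κ M
  have := h1.to_subtype
  have h2 : {l : List {c : List κ | c.length ≤ M} | l.length ≤ n}.Finite :=
    List.finite_length_le _ n
  refine (h2.image (List.map Subtype.val)).subset fun l hl => ?_
  refine ⟨l.attach.map fun c => ⟨c.1, hl.2 c.1 c.2⟩, (by simpa using hl.1 : List.length _ ≤ n), ?_⟩
  simp

end Reduced

section Reduction

variable {k : Type*} [Field k]

/-- The polynomials `f` to which the results apply: irreducible, with unit leading coefficient. -/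
structure IsCurve (f : k[X][X]) : Prop where
  isUnit_leadingCoeff : IsUnit f.leadingCoeff
  irreducible : Irreducible f

namespace IsCurve

variable {f : k[X][X]}

theorem exists_monic (hf : IsCurve f) : ∃ g, g.Monic ∧ Irreducible g ∧ g.natDegree = f.natDegree ∧
    Ideal.span {g} = Ideal.span {f} := by
  obtain ⟨u, hu⟩ := hf.isUnit_leadingCoeff
  have hassoc : Associated (C (↑u⁻¹ : k[X]) * f) f :=
    (associated_isUnit_mul_left_iff (isUnit_C.2 u⁻¹.isUnit)).2 (Associated.refl f)
  refine ⟨C (↑u⁻¹ : k[X]) * f, ?_, hassoc.irreducible_iff.2 hf.irreducible, ?_, ?_⟩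
  · rw [Monic, leadingCoeff_mul, leadingCoeff_C, ← hu, Units.inv_mul]
  · exact natDegree_C_mul (Units.ne_zero _)
  · exact Ideal.span_singleton_eq_span_singleton.2 hassoc

theorem isDomain (hf : IsCurve f) : IsDomain (AdjoinRoot f) :=
  AdjoinRoot.isDomain_of_prime hf.irreducible.prime

theorem ker_mk (f : k[X][X]) : RingHom.ker (AdjoinRoot.mk f) = Ideal.span {f} := by
  ext g
  rw [RingHom.mem_ker, AdjoinRoot.mk_eq_zero, Ideal.mem_span_singleton]

theorem natDegree_pos (hf : IsCurve f) : 0 < f.natDegree := by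
  by_contra! h
  refine hf.irreducible.not_isUnit ?_
  rw [eq_C_of_natDegree_eq_zero (p := f) (by lia), isUnit_C]
  have := hf.isUnit_leadingCoeff
  rwa [leadingCoeff, show f.natDegree = 0 by lia] at this

theorem injective_algebraMap (hf : IsCurve f) :
    Function.Injective (algebraMap k[X] (AdjoinRoot f)) := by
  exact injective_comp_C_of_ker (q := AdjoinRoot.mk f) hf.natDegree_pos (ker_mk f)

theorem exists_isReduced (hf : IsCurve f) {Q : k[X]} (hQ : Q ≠ 0) (g : k[X][X]) :
    ∃ l, IsReduced f.natDegree Q.natDegree l ∧ ∃ u v, g = ofCoeffs₂ l + u * f + v * C Q := by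
  obtain ⟨f', hf', _, hd, hs⟩ := hf.exists_monic
  obtain ⟨w, hw⟩ := Ideal.mem_span_singleton.1 (hs ▸ Ideal.mem_span_singleton_self f')
  let r := g %ₘ f'
  let l := (List.range f.natDegree).map fun i => (List.range Q.natDegree).map (r.coeff i % Q).coeff
  have hr : r.degree < f.natDegree := by
    rw [← hd, ← degree_eq_natDegree hf'.ne_zero]
    exact degree_modByMonic_lt _ hf'
  have hl : ofCoeffs₂ l = ∑ i ∈ Finset.range f.natDegree, monomial i (r.coeff i % Q) := by
    ext1 i
    rw [ofCoeffs₂, coeff_ofCoeffs, finsetSum_coeff]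
    simp only [coeff_monomial, Finset.sum_ite_eq', Finset.mem_range]
    split_ifs with hi
    · have : ofCoeffs ((List.range Q.natDegree).map (r.coeff i % Q).coeff) = r.coeff i % Q :=
        ofCoeffs_map_range (by
          rw [← degree_eq_natDegree hQ]
          exact EuclideanDomain.mod_lt _ hQ)
      simp [List.getD_eq_getElem?_getD, l, hi, this]
    · rw [List.getD_eq_default _ _ (by simpa [l] using hi)]
  refine ⟨l, ⟨by simp [l], by simp [l]⟩, w * (g /ₘ f'),
    ∑ i ∈ Finset.range f.natDegree, monomial i (r.coeff i / Q), ?_⟩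
  have h1 : r = ∑ i ∈ Finset.range f.natDegree, monomial i (r.coeff i) := by
    ext1 i
    rw [finsetSum_coeff]
    simp only [coeff_monomial, Finset.sum_ite_eq', Finset.mem_range]
    split_ifs with hi
    · rfl
    · exact (degree_lt_iff_coeff_zero r _).1 hr i (by lia)
  have h2 : r = ofCoeffs₂ l + (∑ i ∈ Finset.range f.natDegree, monomial i (r.coeff i / Q)) * C Q := by
    rw [hl, Finset.sum_mul, ← Finset.sum_add_distrib]
    conv_lhs => rw [h1]
    refine Finset.sum_congr rfl fun i _ => ?_
    rw [monomial_mul_C, ← map_add, mul_comm, EuclideanDomain.mod_add_div]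
  have h3 : r + f' * (g /ₘ f') = g := modByMonic_add_div g f'
  linear_combination h2 - h3 + (g /ₘ f') * hw

/-- Uniqueness of normal forms, by comparing degrees first in `x` and then in `T`. Lower bounds `n`
and `M` of the degrees are enough, and such bounds are what a certificate can verify by exhibiting
nonzero coefficients. -/
theorem eq_of_dvd_sub (hf : IsCurve f) {Q : k[X]} {n M : ℕ} (hn : n ≤ f.natDegree)
    (hM : M ≤ Q.natDegree) {l l' : List (List k)} (hl : IsReduced n M l) (hl' : IsReduced n M l')
    (h : algebraMap k[X] (AdjoinRoot f) Q ∣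
      AdjoinRoot.mk f (ofCoeffs₂ l) - AdjoinRoot.mk f (ofCoeffs₂ l')) :
    ofCoeffs₂ l = ofCoeffs₂ l' := by
  obtain ⟨f', hf', _, hd, hs⟩ := hf.exists_monic
  obtain ⟨h, hh⟩ := h
  obtain ⟨h, rfl⟩ := AdjoinRoot.mk_surjective h
  have hmod : AdjoinRoot.mk f h = AdjoinRoot.mk f (h %ₘ f') := by
    rw [← sub_eq_zero, ← map_sub, ← RingHom.mem_ker, ker_mk, ← hs, Ideal.mem_span_singleton]
    exact ⟨h /ₘ f', by linear_combination -modByMonic_add_div h f'⟩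
  set r := h %ₘ f'
  have hr : r.degree < f'.degree := degree_modByMonic_lt _ hf'
  have hdeg : ∀ {l : List (List k)}, IsReduced n M l → (ofCoeffs₂ l).degree < f'.degree := by
    intro l hl
    rw [degree_eq_natDegree hf'.ne_zero, hd]
    exact degree_ofCoeffs_lt (by simpa using hl.1.trans hn)
  have h0 : ofCoeffs₂ l - ofCoeffs₂ l' - C Q * r = 0 := by
    refine eq_zero_of_dvd_of_degree_lt (p := f') ?_ ?_
    · rw [← Ideal.mem_span_singleton, hs, ← ker_mk, RingHom.mem_ker, map_sub, map_sub, map_mul, hh,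
        hmod]
      exact sub_self _
    · refine (degree_sub_le _ _).trans_lt (max_lt ((degree_sub_le _ _).trans_lt
        (max_lt (hdeg hl) (hdeg hl'))) ?_)
      rw [← smul_eq_C_mul]
      exact (degree_smul_le Q r).trans_lt hr
  ext1 i
  have hi := congrArg (fun g => coeff g i) h0
  simp only [coeff_sub, coeff_C_mul, coeff_zero] at hi
  have hdeg' : ∀ {l : List (List k)}, IsReduced n M l → ((ofCoeffs₂ l).coeff i).degree < M := by
    intro l hl
    rw [ofCoeffs₂, coeff_ofCoeffs]
    by_cases hi : i < l.length
    · simp only [List.getD_eq_getElem?_getD, List.getElem?_map, List.getElem?_eq_getElem hi,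
        Option.map_some, Option.getD_some]
      exact degree_ofCoeffs_lt (hl.2 _ (List.getElem_mem hi))
    · rw [List.getD_eq_default _ _ (by simpa using hi), degree_zero]
      exact WithBot.bot_lt_coe _
  rw [← sub_eq_zero]
  by_cases hQ : Q = 0
  · simpa [hQ] using hi
  refine eq_zero_of_dvd_of_degree_lt (p := Q) ⟨r.coeff i, by linear_combination hi⟩ ?_
  refine (degree_sub_le _ _).trans_lt (max_lt ?_ ?_) <;> rw [degree_eq_natDegree hQ]
  · exact (hdeg' hl).trans_le (Nat.cast_le.2 hM)
  · exact (hdeg' hl').trans_le (Nat.cast_le.2 hM)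

theorem finite_quotient [Finite k] (hf : IsCurve f) {Q : k[X]} (hQ : Q ≠ 0) :
    Finite (AdjoinRoot f ⧸ Ideal.span {algebraMap k[X] (AdjoinRoot f) Q}) := by
  have := (finite_isReduced (κ := k) f.natDegree Q.natDegree).to_subtype
  refine Finite.of_surjective (fun l : {l : List (List k) | IsReduced f.natDegree Q.natDegree l} =>
    Ideal.Quotient.mk _ (AdjoinRoot.mk f (ofCoeffs₂ l.1))) fun y => ?_
  obtain ⟨y, rfl⟩ := Ideal.Quotient.mk_surjective y
  obtain ⟨g, rfl⟩ := AdjoinRoot.mk_surjective y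
  obtain ⟨l, hl, u, v, rfl⟩ := hf.exists_isReduced hQ g
  refine ⟨⟨l, hl⟩, ?_⟩
  simp only
  rw [eq_comm, Ideal.Quotient.eq, Ideal.mem_span_singleton]
  refine ⟨AdjoinRoot.mk f v, ?_⟩
  rw [map_add, map_add, map_mul, map_mul, AdjoinRoot.mk_self]
  change _ + _ + _ * algebraMap k[X] (AdjoinRoot f) Q - _ = _
  ring

theorem map_span_eq (f : k[X][X]) (P : k[X]) : (Ideal.span {P}).map (algebraMap k[X] (AdjoinRoot f)) =
    Ideal.span {algebraMap k[X] (AdjoinRoot f) P} := by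
  rw [Ideal.map_span, Set.image_singleton]

/-- The image of `P` in the completion of `k[T][x]/(f)` at `P`. -/
noncomputable def _root_.IdealClasses.completedPrime (f : k[X][X]) (P : k[X]) : CompletedOrder f P :=
  algebraMap (AdjoinRoot f) (CompletedOrder f P) (algebraMap k[X] (AdjoinRoot f) P)

theorem finitelyComplete [Finite k] (hf : IsCurve f) {P : k[X]} (hP : P ≠ 0) :
    FinitelyComplete (completedPrime f P) := by
  have := hf.isDomain
  refine adicCompletion_finitelyComplete (map_span_eq f P) (mem_nonZeroDivisors_of_ne_zero ?_) ?_
  · rwa [Ne, map_eq_zero_iff _ hf.injective_algebraMap]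
  · intro n
    rw [← map_pow]
    exact hf.finite_quotient (pow_ne_zero n hP)

/-- `R` is integral over `k[T]`, so the nonzero ideal `(D)` meets `k[T]` in a nonzero ideal. -/
theorem exists_multiple (hf : IsCurve f) {D : AdjoinRoot f} (hD : D ≠ 0) :
    ∃ a : k[X], a ≠ 0 ∧ D ∣ algebraMap k[X] (AdjoinRoot f) a := by
  have := hf.isDomain
  obtain ⟨f', hf', _, hd, hs⟩ := hf.exists_monic
  have hDint : IsIntegral k[X] D := by
    refine isIntegral_of_generator (algebraMap k[X] (AdjoinRoot f)) (AdjoinRoot.root f) ?_ hf' ?_ D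
    · intro r
      obtain ⟨g, rfl⟩ := AdjoinRoot.mk_surjective r
      exact ⟨g, AdjoinRoot.aeval_eq g⟩
    · refine (AdjoinRoot.aeval_eq f').trans ?_
      rw [← RingHom.mem_ker, ker_mk, ← hs]
      exact Ideal.mem_span_singleton_self _
  have := Ideal.comap_ne_bot_of_integral_mem hD (Ideal.mem_span_singleton_self D) hDint
  obtain ⟨a, ha, ha0⟩ := Submodule.exists_mem_ne_zero_of_ne_bot this
  exact ⟨a, ha0, Ideal.mem_span_singleton.1 ha⟩

/-- Write `a = P ^ m * b` with `b` prime to `P`. A Bézout relation makes `b` a unit of the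
completion. -/
theorem exists_dvd_completedPrime_pow [Finite k] (hf : IsCurve f) {P : k[X]} (hP : Irreducible P)
    {a : k[X]} (ha : a ≠ 0) : ∃ m, algebraMap (AdjoinRoot f) (CompletedOrder f P)
      (algebraMap k[X] (AdjoinRoot f) a) ∣ completedPrime f P ^ m := by
  obtain ⟨m, b, hb, rfl⟩ := WfDvdMonoid.max_power_factor ha hP
  obtain ⟨x, y, hxy⟩ := (hP.coprime_iff_not_dvd.2 hb)
  let φ := (algebraMap (AdjoinRoot f) (CompletedOrder f P)).comp (algebraMap k[X] (AdjoinRoot f))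
  have hu : IsUnit (φ b) := by
    have h1 : φ x * completedPrime f P + φ y * φ b = 1 := by
      have := congrArg φ hxy
      rwa [map_add, map_mul, map_mul, map_one] at this
    have h2 := (hf.finitelyComplete hP.ne_zero).isUnit_one_add_mul (-φ x)
    have h3 : 1 + completedPrime f P * (-φ x) = φ y * φ b := by linear_combination -h1
    rw [h3] at h2
    exact isUnit_of_mul_isUnit_right h2
  refine ⟨m, ?_⟩
  change φ _ ∣ φ P ^ m
  rw [map_mul, map_pow]
  exact hu.mul_right_dvd.2 dvd_rfl

/-- All ideal classes of the completion have representatives that contain a common power of `P`. -/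
theorem exists_bound [Finite k] (hf : IsCurve f) {P : k[X]} (hP : Irreducible P) :
    ∃ t, ∀ (I : Ideal (CompletedOrder f P)) (n : ℕ), completedPrime f P ^ n ∈ I →
      ∃ L, completedPrime f P ^ t ∈ L ∧ SameClass I L := by
  have := hf.isDomain
  have : IsNoetherianRing (AdjoinRoot f) :=
    isNoetherianRing_of_surjective _ _ (AdjoinRoot.mk f) AdjoinRoot.mk_surjective
  obtain ⟨f', hf', hirr, hd, hs⟩ := hf.exists_monic
  obtain ⟨hO, hfin⟩ := normalization_finite hf' hirr (AdjoinRoot.mk f) AdjoinRoot.mk_surjective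
    ((ker_mk f).trans hs.symm)
  obtain ⟨s, hsp⟩ := hfin
  obtain ⟨D, hD⟩ := IsLocalization.exist_integer_multiples (nonZeroDivisors (AdjoinRoot f)) s
    (fun o : integralClosure (AdjoinRoot f) (FractionRing (AdjoinRoot f)) =>
      (o : FractionRing (AdjoinRoot f)))
  have hDO : ∀ o : integralClosure (AdjoinRoot f) (FractionRing (AdjoinRoot f)), ∃ r,
      algebraMap (AdjoinRoot f) _ r = algebraMap (AdjoinRoot f) _ (D : AdjoinRoot f) * o := by
    intro o
    have ho : o ∈ Submodule.span (AdjoinRoot f) (s : Set _) := hsp ▸ Submodule.mem_top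
    induction ho using Submodule.span_induction with
    | mem o ho =>
      obtain ⟨r, hr⟩ := hD o ho
      refine ⟨r, Subtype.ext ?_⟩
      rw [← Algebra.smul_def]
      exact hr
    | zero => exact ⟨0, by simp⟩
    | add o o' _ _ h h' =>
      obtain ⟨r, hr⟩ := h
      obtain ⟨r', hr'⟩ := h'
      exact ⟨r + r', by rw [map_add, hr, hr', mul_add]⟩
    | smul a o _ h =>
      obtain ⟨r, hr⟩ := h
      exact ⟨a * r, by rw [map_mul, hr, Algebra.smul_def]; ring⟩
  -- The common denominator `D` divides an element of `k[T]`, hence a power `P ^ m` in the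
  -- completion. The bound is the exponent `2 * m` of `D²`.
  obtain ⟨a, ha, hDa⟩ := hf.exists_multiple (nonZeroDivisors.ne_zero D.2)
  obtain ⟨m, hm⟩ := hf.exists_dvd_completedPrime_pow hP ha
  refine ⟨2 * m, fun I n hI => exists_pow_mem_of_multiples
    (integralClosure (AdjoinRoot f) (FractionRing (AdjoinRoot f))) (map_span_eq f P) ?_
    (hf.finitelyComplete hP.ne_zero) ?_ hDO ((_root_.map_dvd _ hDa).trans hm) I n hI⟩
  · rw [Ne, map_eq_zero_iff _ hf.injective_algebraMap]
    exact hP.ne_zero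
  · exact FaithfulSMul.algebraMap_injective _ _

end IsCurve

end Reduction

/-! ### Closure rules for primitive recursive functions and predicates -/

section PrimitiveRecursion

variable {α β γ : Type*} [Primcodable α] [Primcodable β] [Primcodable γ]

attribute [fun_prop] Primrec
attribute [fun_prop] Primrec.id Primrec.const Primrec.comp

@[fun_prop]
theorem primrec_pair {f : α → β} {g : α → γ} (hf : Primrec f) (hg : Primrec g) :
    Primrec fun a => (f a, g a) := hf.pair hg

@[fun_prop]
theorem primrec_fst {f : α → β × γ} (hf : Primrec f) : Primrec fun a => (f a).1 :=
  Primrec.fst.comp hf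

@[fun_prop]
theorem primrec_snd {f : α → β × γ} (hf : Primrec f) : Primrec fun a => (f a).2 :=
  Primrec.snd.comp hf

@[fun_prop]
theorem primrec_add {f g : α → ℕ} (hf : Primrec f) (hg : Primrec g) :
    Primrec fun a => f a + g a := Primrec.nat_add.comp hf hg

@[fun_prop]
theorem primrec_mul {f g : α → ℕ} (hf : Primrec f) (hg : Primrec g) :
    Primrec fun a => f a * g a := Primrec.nat_mul.comp hf hg

@[fun_prop]
theorem primrec_map {f : α → List β} {g : α → β → γ} (hf : Primrec f)
    (hg : Primrec fun x : α × β => g x.1 x.2) : Primrec fun a => (f a).map (g a) :=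
  Primrec.list_map hf hg

@[fun_prop]
theorem primrec_flatMap {f : α → List β} {g : α → β → List γ} (hf : Primrec f)
    (hg : Primrec fun x : α × β => g x.1 x.2) : Primrec fun a => (f a).flatMap (g a) :=
  Primrec.list_flatMap hf hg

@[fun_prop]
theorem primrec_foldr {f : α → List β} {g : α → γ} {h : α → β → γ → γ} (hf : Primrec f)
    (hg : Primrec g) (hh : Primrec fun x : α × β × γ => h x.1 x.2.1 x.2.2) :
    Primrec fun a => (f a).foldr (h a) (g a) :=
  (Primrec.list_foldr (h := fun a (x : β × γ) => h a x.1 x.2) hf hg hh).of_eq fun _ => rfl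

@[fun_prop]
theorem primrec_range {f : α → ℕ} (hf : Primrec f) : Primrec fun a => List.range (f a) :=
  Primrec.list_range.comp hf

@[fun_prop]
theorem primrec_length {f : α → List β} (hf : Primrec f) : Primrec fun a => (f a).length :=
  Primrec.list_length.comp hf

@[fun_prop]
theorem primrec_cons {f : α → β} {g : α → List β} (hf : Primrec f) (hg : Primrec g) :
    Primrec fun a => f a :: g a := Primrec.list_cons.comp hf hg

@[fun_prop]
theorem primrec_append {f g : α → List β} (hf : Primrec f) (hg : Primrec g) :
    Primrec fun a => f a ++ g a := Primrec.list_append.comp hf hg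

@[fun_prop]
theorem primrec_getD {f : α → List β} {g : α → ℕ} (d : β) (hf : Primrec f) (hg : Primrec g) :
    Primrec fun a => (f a).getD (g a) d := (Primrec.list_getD d).comp hf hg

@[fun_prop]
theorem primrec_getElem? {f : α → List β} {g : α → ℕ} (hf : Primrec f) (hg : Primrec g) :
    Primrec fun a => (f a)[g a]? := Primrec.list_getElem?.comp hf hg

@[fun_prop]
theorem primrec_some {f : α → β} (hf : Primrec f) : Primrec fun a => some (f a) :=
  Primrec.option_some.comp hf

theorem primrecPred_forall_mem {l : α → List β} {q : α → β → Prop} (hl : Primrec l)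
    (hq : PrimrecPred fun x : α × β => q x.1 x.2) : PrimrecPred fun a => ∀ b ∈ l a, q a b := by
  have h1 : PrimrecRel fun (b : β) (a : α) => q a b :=
    hq.comp (Primrec.pair Primrec.snd Primrec.fst)
  exact h1.forall_mem_list.comp hl Primrec.id

theorem primrecPred_exists_mem {l : α → List β} {q : α → β → Prop} (hl : Primrec l)
    (hq : PrimrecPred fun x : α × β => q x.1 x.2) : PrimrecPred fun a => ∃ b ∈ l a, q a b := by
  have h1 : PrimrecRel fun (b : β) (a : α) => q a b :=
    hq.comp (Primrec.pair Primrec.snd Primrec.fst)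
  exact h1.exists_mem_list.comp hl Primrec.id

theorem primrecPred_eq {f g : α → β} (hf : Primrec f) (hg : Primrec g) :
    PrimrecPred fun a => f a = g a := Primrec.eq.comp hf hg

theorem primrecPred_le {f g : α → ℕ} (hf : Primrec f) (hg : Primrec g) :
    PrimrecPred fun a => f a ≤ g a := Primrec.nat_le.comp hf hg

theorem primrecPred_imp {p q : α → Prop} (hp : PrimrecPred p) (hq : PrimrecPred q) :
    PrimrecPred fun a => p a → q a := (hp.not.or hq).of_eq fun _ => imp_iff_not_or.symm

theorem primrecPred_mem {f : α → β} {l : α → List β} (hf : Primrec f) (hl : Primrec l) :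
    PrimrecPred fun a => f a ∈ l a :=
  (primrecPred_exists_mem hl (q := fun a b => b = f a)
    (primrecPred_eq Primrec.snd (hf.comp Primrec.fst))).of_eq fun a => by simp

theorem primrecPred_forall_lt {n : α → ℕ} {q : α → ℕ → Prop} (hn : Primrec n)
    (hq : PrimrecPred fun x : α × ℕ => q x.1 x.2) : PrimrecPred fun a => ∀ i < n a, q a i :=
  (primrecPred_forall_mem (Primrec.list_range.comp hn) hq).of_eq fun a => by simp

theorem primrecPred_exists_lt {n : α → ℕ} {q : α → ℕ → Prop} (hn : Primrec n)
    (hq : PrimrecPred fun x : α × ℕ => q x.1 x.2) : PrimrecPred fun a => ∃ i < n a, q a i :=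
  (primrecPred_exists_mem (Primrec.list_range.comp hn) hq).of_eq fun a => by simp

end PrimitiveRecursion

/-! ### Polynomial arithmetic on coefficient lists -/

section ListArithmetic

variable {σ S : Type*} [Semiring S]

/-- Addition of coefficient lists, over a ring whose elements are encoded in `σ`. -/
def addList (z : σ) (add : σ → σ → σ) (a b : List σ) : List σ :=
  (List.range (a.length + b.length)).map fun i => add (a.getD i z) (b.getD i z)

/-- Multiplication of coefficient lists, over a ring whose elements are encoded in `σ`. -/
def mulList (z : σ) (add mul : σ → σ → σ) (a b : List σ) : List σ :=
  a.foldr (fun x acc => addList z add (b.map fun y => mul x y) (z :: acc)) []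

theorem getD_map_of_eq {φ : σ → S} {z : σ} (hz : φ z = 0) (l : List σ) (i : ℕ) :
    (l.map φ).getD i 0 = φ (l.getD i z) := by
  rw [← hz, List.getD_map]

theorem ofCoeffs_map_addList {φ : σ → S} {z : σ} {add : σ → σ → σ} (hz : φ z = 0)
    (hadd : ∀ x y, φ (add x y) = φ x + φ y) (a b : List σ) :
    ofCoeffs ((addList z add a b).map φ) = ofCoeffs (a.map φ) + ofCoeffs (b.map φ) := by
  ext i
  rw [Polynomial.coeff_add, coeff_ofCoeffs, coeff_ofCoeffs, coeff_ofCoeffs, getD_map_of_eq hz,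
    getD_map_of_eq hz, getD_map_of_eq hz, ← hadd]
  by_cases hi : i < a.length + b.length
  · simp [addList, List.getD_eq_getElem?_getD, hi]
  · rw [List.getD_eq_default _ _ (by simpa [addList] using hi), hadd,
      List.getD_eq_default a _ (by lia), List.getD_eq_default b _ (by lia), hz, add_zero]

theorem ofCoeffs_map_mulList {φ : σ → S} {z : σ} {add mul : σ → σ → σ} (hz : φ z = 0)
    (hadd : ∀ x y, φ (add x y) = φ x + φ y) (hmul : ∀ x y, φ (mul x y) = φ x * φ y)
    (a b : List σ) :
    ofCoeffs ((mulList z add mul a b).map φ) = ofCoeffs (a.map φ) * ofCoeffs (b.map φ) := by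
  induction a with
  | nil => simp [mulList, ofCoeffs]
  | cons x a ih =>
    have hsmul : ofCoeffs ((b.map fun y => mul x y).map φ) =
        Polynomial.C (φ x) * ofCoeffs (b.map φ) := by
      ext i
      rw [Polynomial.coeff_C_mul, coeff_ofCoeffs, coeff_ofCoeffs, List.map_map]
      by_cases hi : i < b.length
      · simp [List.getD_eq_getElem?_getD, hi, hmul]
      · rw [List.getD_eq_default _ _ (by simpa using hi),
          List.getD_eq_default _ _ (by simpa using hi), mul_zero]
    rw [mulList, List.foldr_cons, ofCoeffs_map_addList hz hadd, hsmul]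
    change _ + (Polynomial.C (φ z) + Polynomial.X * ofCoeffs ((mulList z add mul a b).map φ)) =
      (Polynomial.C (φ x) + Polynomial.X * ofCoeffs (a.map φ)) * _
    rw [ih, hz, Polynomial.C_0, zero_add, add_mul, mul_assoc]

/-- Trailing zeros make lists non-unique, so polynomials are compared coefficient by coefficient.
Beyond the sum of the lengths both sides take the default `z`. -/
theorem ofCoeffs_map_eq_iff {φ : σ → S} {z : σ} (hz : φ z = 0) (a b : List σ) :
    ofCoeffs (a.map φ) = ofCoeffs (b.map φ) ↔
      ∀ i < a.length + b.length, φ (a.getD i z) = φ (b.getD i z) := by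
  rw [Polynomial.ext_iff]
  simp only [coeff_ofCoeffs, getD_map_of_eq hz]
  refine ⟨fun h i _ => h i, fun h i => ?_⟩
  by_cases hi : i < a.length + b.length
  · exact h i hi
  · rw [List.getD_eq_default a _ (by lia), List.getD_eq_default b _ (by lia)]

variable {α : Type*} [Primcodable α] [Primcodable σ]

theorem primrec_addList {z : σ} {add : σ → σ → σ} (hadd : Primrec₂ add) {f g : α → List σ}
    (hf : Primrec f) (hg : Primrec g) : Primrec fun a => addList z add (f a) (g a) := by
  unfold addList
  refine primrec_map (by fun_prop) (hadd.comp (by fun_prop) (by fun_prop))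

theorem primrec_mulList {z : σ} {add mul : σ → σ → σ} (hadd : Primrec₂ add) (hmul : Primrec₂ mul)
    {f g : α → List σ} (hf : Primrec f) (hg : Primrec g) :
    Primrec fun a => mulList z add mul (f a) (g a) := by
  unfold mulList
  refine primrec_foldr hf (by fun_prop) (primrec_addList hadd ?_ (by fun_prop))
  exact primrec_map (by fun_prop) (hmul.comp (by fun_prop) (by fun_prop))

theorem primrecRel_ofCoeffs_map_eq {φ : σ → S} {z : σ} (hz : φ z = 0)
    (h : PrimrecRel fun x y => φ x = φ y) {f g : α → List σ} (hf : Primrec f) (hg : Primrec g) :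
    PrimrecPred fun a => ofCoeffs ((f a).map φ) = ofCoeffs ((g a).map φ) := by
  simp only [ofCoeffs_map_eq_iff hz]
  exact primrecPred_forall_lt (by fun_prop) (h.comp (by fun_prop) (by fun_prop))

end ListArithmetic

section BivariateArithmetic

variable {k : Type*} [Field k]

/-- Addition of coefficient lists over `k`. -/
def addCoeffs (a b : List k) : List k := addList 0 (fun x y => x + y) a b

/-- Multiplication of coefficient lists over `k`. -/
def mulCoeffs (a b : List k) : List k := mulList 0 (fun x y => x + y) (fun x y => x * y) a b

/-- Powers of coefficient lists over `k`. -/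
def powCoeffs (a : List k) (n : ℕ) : List k := (List.range n).foldr (fun _ b => mulCoeffs a b) [1]

/-- Addition of coefficient lists over `k[X]`. -/
def addCoeffs₂ (a b : List (List k)) : List (List k) := addList [] addCoeffs a b

/-- Multiplication of coefficient lists over `k[X]`. -/
def mulCoeffs₂ (a b : List (List k)) : List (List k) := mulList [] addCoeffs mulCoeffs a b

theorem ofCoeffs_addCoeffs (a b : List k) :
    ofCoeffs (addCoeffs a b) = ofCoeffs a + ofCoeffs b := by
  simpa [addCoeffs] using ofCoeffs_map_addList (φ := (id : k → k)) rfl (fun _ _ => rfl) a b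

theorem ofCoeffs_mulCoeffs (a b : List k) :
    ofCoeffs (mulCoeffs a b) = ofCoeffs a * ofCoeffs b := by
  simpa [mulCoeffs] using ofCoeffs_map_mulList (φ := (id : k → k)) rfl (fun _ _ => rfl)
    (fun _ _ => rfl) a b

theorem ofCoeffs_powCoeffs (a : List k) (n : ℕ) : ofCoeffs (powCoeffs a n) = ofCoeffs a ^ n := by
  have : ∀ l : List ℕ, ofCoeffs (l.foldr (fun _ b => mulCoeffs a b) [1]) =
      ofCoeffs a ^ l.length := by
    intro l
    induction l with
    | nil => simp [ofCoeffs]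
    | cons x l ih => rw [List.foldr_cons, ofCoeffs_mulCoeffs, ih, List.length_cons, pow_succ']
  rw [powCoeffs, this, List.length_range]

theorem ofCoeffs₂_addCoeffs₂ (a b : List (List k)) :
    ofCoeffs₂ (addCoeffs₂ a b) = ofCoeffs₂ a + ofCoeffs₂ b :=
  ofCoeffs_map_addList (φ := ofCoeffs) (z := []) rfl ofCoeffs_addCoeffs a b

theorem ofCoeffs₂_mulCoeffs₂ (a b : List (List k)) :
    ofCoeffs₂ (mulCoeffs₂ a b) = ofCoeffs₂ a * ofCoeffs₂ b :=
  ofCoeffs_map_mulList (φ := ofCoeffs) (z := []) rfl ofCoeffs_addCoeffs ofCoeffs_mulCoeffs a b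

theorem ofCoeffs₂_singleton (a : List k) : ofCoeffs₂ [a] = Polynomial.C (ofCoeffs a) := by
  simp [ofCoeffs₂, ofCoeffs]

theorem exists_ofCoeffs₂_eq (g : k[X][X]) : ∃ l, ofCoeffs₂ l = g := by
  have h1 : ∀ a : k[X], ∃ l, ofCoeffs l = a := fun a =>
    ⟨_, ofCoeffs_map_range (Polynomial.degree_lt_iff_coeff_zero _ _ |>.2
      fun i (hi : a.natDegree + 1 ≤ i) => Polynomial.coeff_eq_zero_of_natDegree_lt hi)⟩
  choose c hc using h1
  refine ⟨(List.range (g.natDegree + 1)).map fun i => c (g.coeff i), ?_⟩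
  rw [ofCoeffs₂, List.map_map]
  have : (ofCoeffs ∘ fun i => c (g.coeff i)) = g.coeff := funext fun i => hc _
  rw [this]
  exact ofCoeffs_map_range (Polynomial.degree_lt_iff_coeff_zero _ _ |>.2
      fun i (hi : g.natDegree + 1 ≤ i) => Polynomial.coeff_eq_zero_of_natDegree_lt hi)

variable [Primcodable k] {α : Type*} [Primcodable α]

theorem primrecPred_ofCoeffs₂_eq {f g : α → List (List k)} (hf : Primrec f) (hg : Primrec g) :
    PrimrecPred fun a => ofCoeffs₂ (f a) = ofCoeffs₂ (g a) := by
  refine primrecRel_ofCoeffs_map_eq (φ := ofCoeffs) (z := []) rfl ?_ hf hg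
  have := primrecRel_ofCoeffs_map_eq (φ := (id : k → k)) (z := 0) rfl Primrec.eq
    (Primrec.fst (α := List k) (β := List k)) Primrec.snd
  simp only [List.map_id] at this
  exact this

variable [Finite k]

@[fun_prop]
theorem primrec_addCoeffs {f g : α → List k} (hf : Primrec f) (hg : Primrec g) :
    Primrec fun a => addCoeffs (f a) (g a) := primrec_addList (Primrec.dom_finite _) hf hg

@[fun_prop]
theorem primrec_mulCoeffs {f g : α → List k} (hf : Primrec f) (hg : Primrec g) :
    Primrec fun a => mulCoeffs (f a) (g a) :=
  primrec_mulList (Primrec.dom_finite _) (Primrec.dom_finite _) hf hg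

@[fun_prop]
theorem primrec_powCoeffs {f : α → List k} {n : α → ℕ} (hf : Primrec f) (hn : Primrec n) :
    Primrec fun a => powCoeffs (f a) (n a) := by
  unfold powCoeffs
  fun_prop

@[fun_prop]
theorem primrec_addCoeffs₂ {f g : α → List (List k)} (hf : Primrec f) (hg : Primrec g) :
    Primrec fun a => addCoeffs₂ (f a) (g a) :=
  primrec_addList (primrec_addCoeffs Primrec.fst Primrec.snd) hf hg

@[fun_prop]
theorem primrec_mulCoeffs₂ {f g : α → List (List k)} (hf : Primrec f) (hg : Primrec g) :
    Primrec fun a => mulCoeffs₂ (f a) (g a) :=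
  primrec_mulList (primrec_addCoeffs Primrec.fst Primrec.snd)
    (primrec_mulCoeffs Primrec.fst Primrec.snd) hf hg

end BivariateArithmetic

section Subsets

variable {σ : Type*}

/-- All sublists of a list. -/
def sublistsList (l : List σ) : List (List σ) :=
  l.foldr (fun a acc => acc ++ acc.map fun s => a :: s) [[]]

/-- The elements of the model that lie in a given ideal form a filter of the list of all elements.
Hence a search through `sublistsList` meets every ideal of the model. -/
theorem filter_mem_sublistsList (l : List σ) (p : σ → Bool) : l.filter p ∈ sublistsList l := by
  induction l with
  | nil => simp [sublistsList]
  | cons a l ih =>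
    change _ ∈ sublistsList l ++ (sublistsList l).map fun s => a :: s
    rw [List.mem_append, List.mem_map, List.filter_cons]
    split_ifs
    · exact Or.inr ⟨_, ih, rfl⟩
    · exact Or.inl ih

@[fun_prop]
theorem primrec_sublistsList [Primcodable σ] {α : Type*} [Primcodable α] {f : α → List σ}
    (hf : Primrec f) : Primrec fun a => sublistsList (f a) := by
  unfold sublistsList
  fun_prop

end Subsets

/-! ### Finite models, certificates and their primitive recursive verification -/

section Certificates

variable {k : Type*} [Field k]

/-- The data of a finite model of `k[T][x]/(f, P ^ N)`: the coefficients of `f` and `P`; numbers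
`t`, `n` and `d`, of which `t` determines `N` and the two others bound the degrees of `f` and
`P`; the elements of the model; and the multipliers of `f` and `P ^ N` that are used in reductions to
these elements. -/
abbrev ModelData (k : Type*) :=
  (List (List k) × List k) × (ℕ × ℕ × ℕ) × List (List (List k)) ×
    List (List (List k) × List (List k))

namespace ModelData

/-- The coefficients of `f`. -/
abbrev poly (M : ModelData k) : List (List k) := M.1.1

/-- The coefficients of `P`. -/
abbrev prime (M : ModelData k) : List k := M.1.2

/-- All ideals of the list of representatives contain `P ^ t`. -/
abbrev level (M : ModelData k) : ℕ := M.2.1.1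

/-- All ideals under consideration contain `P ^ m`. -/
abbrev idealLevel (M : ModelData k) : ℕ := 2 * M.level + 1

/-- The exponent `N` of the modulus `P ^ N`. -/
abbrev precision (M : ModelData k) : ℕ := 2 * M.idealLevel + 1

/-- A lower bound of the degree of `f`. -/
abbrev polyDeg (M : ModelData k) : ℕ := M.2.1.2.1

/-- A lower bound of the degree of `P`. -/
abbrev primeDeg (M : ModelData k) : ℕ := M.2.1.2.2

/-- The elements of the model. -/
abbrev elems (M : ModelData k) : List (List (List k)) := M.2.2.1

/-- The multipliers for reductions. -/
abbrev mults (M : ModelData k) : List (List (List k) × List (List k)) := M.2.2.2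

/-- The power `P ^ i`. -/
def primePow (M : ModelData k) (i : ℕ) : List (List k) := [powCoeffs M.prime i]

/-- The polynomial `a` is reduced to `e` by one of the multipliers. -/
def ReducesTo (M : ModelData k) (a e : List (List k)) : Prop :=
  ∃ w ∈ M.mults, ofCoeffs₂ a = ofCoeffs₂ (addCoeffs₂ e
    (addCoeffs₂ (mulCoeffs₂ w.1 M.poly) (mulCoeffs₂ w.2 (M.primePow M.precision))))

/-- The polynomial `a` is reduced to an element of the model. -/
def Reducible (M : ModelData k) (a : List (List k)) : Prop := ∃ e ∈ M.elems, M.ReducesTo a e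

/-- The polynomials `a` and `b` are reduced to the same element of the model. -/
def Congr (M : ModelData k) (a b : List (List k)) : Prop :=
  ∃ e ∈ M.elems, M.ReducesTo a e ∧ M.ReducesTo b e

/-- The polynomials that have to be reducible. -/
def required (κ : List k) (M : ModelData k) : List (List (List k)) :=
  M.elems ++ (M.elems.flatMap fun a => M.elems.map fun b => addCoeffs₂ a b) ++
    (M.elems.flatMap fun a => M.elems.map fun b => mulCoeffs₂ a b) ++
    ((List.range M.precision).map fun i => M.primePow i) ++
    ((List.range M.precision).flatMap fun i => M.elems.map fun b => mulCoeffs₂ (M.primePow i) b) ++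
    (κ.map fun c => [[c]]) ++ [[[0, 1]], [[], [1]]]

/-- The data describe `k[T][x]/(f, P ^ N)`; here `κ` is the list of all elements of `k`. -/
def IsModel (κ : List k) (M : ModelData k) : Prop :=
  M.prime.getD M.primeDeg 0 ≠ 0 ∧ (∃ c ∈ M.poly.getD M.polyDeg [], c ≠ 0) ∧
    (∀ e ∈ M.elems, e.length ≤ M.polyDeg ∧ ∀ c ∈ e, c.length ≤ M.primeDeg * M.precision) ∧
    ∀ a ∈ M.required κ, M.Reducible a

/-- The list consists of the elements of an ideal that contains `P ^ m`. -/
def IsIdeal (M : ModelData k) (L : List (List (List k))) : Prop :=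
  (∀ a ∈ L, a ∈ M.elems) ∧ (∃ a ∈ L, M.Congr a (M.primePow M.idealLevel)) ∧
    (∀ a ∈ L, ∀ b ∈ L, ∃ c ∈ L, M.Congr (addCoeffs₂ a b) c) ∧
    ∀ a ∈ M.elems, ∀ b ∈ L, ∃ c ∈ L, M.Congr (mulCoeffs₂ a b) c

/-- Two ideals are in the same class. -/
def Equivalent (M : ModelData k) (L L' : List (List (List k))) : Prop :=
  ∃ y ∈ M.elems, ∃ z ∈ M.elems, M.Congr (mulCoeffs₂ y z) (M.primePow (2 * M.idealLevel)) ∧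
    (∀ a ∈ L, ∃ b ∈ L', M.Congr (mulCoeffs₂ y a) (mulCoeffs₂ (M.primePow M.idealLevel) b)) ∧
    ∀ b ∈ L', ∃ a ∈ L, M.Congr (mulCoeffs₂ z b) (mulCoeffs₂ (M.primePow M.idealLevel) a)

/-- An ideal contains the product of two others. -/
def ContainsProduct (M : ModelData k) (J L L' : List (List (List k))) : Prop :=
  ∀ a ∈ L, ∀ b ∈ L', ∃ c ∈ J, M.Congr (mulCoeffs₂ a b) c

/-- One ideal is contained in another. -/
def Contained (M : ModelData k) (J J' : List (List (List k))) : Prop :=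
  ∀ a ∈ J, ∃ b ∈ J', M.Congr a b

/-- The ideal `J` is the product of `L` and `L'`. -/
def IsProduct (M : ModelData k) (J L L' : List (List (List k))) : Prop :=
  M.IsIdeal J ∧ M.ContainsProduct J L L' ∧
    ∀ J' ∈ sublistsList M.elems, M.IsIdeal J' → M.ContainsProduct J' L L' → M.Contained J J'

/-- The output consists of ideals of the model which represent every class exactly once, and the
multiplication table of the classes. -/
def Certifies (M : ModelData k) (out : List (List (List (List k))) × List (List ℕ)) : Prop :=
  (∀ L ∈ out.1, M.IsIdeal L ∧ ∃ a ∈ L, M.Congr a (M.primePow M.level)) ∧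
    (∀ i < out.1.length, ∀ j < out.1.length, M.Equivalent (out.1.getD i []) (out.1.getD j []) →
      i = j) ∧
    (∃ L ∈ out.1, M.Equivalent L M.elems) ∧
    (∀ L ∈ out.1, ∀ J ∈ sublistsList M.elems, M.IsIdeal J → M.Contained J L →
      (∀ a ∈ L, ∃ b ∈ J, M.Congr (mulCoeffs₂ (M.primePow 1) a) b) →
      ∃ L' ∈ out.1, M.Equivalent L' J) ∧
    ∀ i < out.1.length, ∀ j < out.1.length, ∃ r < out.1.length,
      (out.2.getD i [])[j]? = some r ∧ ∃ J ∈ sublistsList M.elems,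
        M.IsProduct J (out.1.getD i []) (out.1.getD j []) ∧ M.Equivalent (out.1.getD r []) J

section PrimitiveRecursive

variable [Finite k] [Primcodable k] {α : Type*} [Primcodable α] {M : α → ModelData k}

@[fun_prop]
theorem primrec_primePow (hM : Primrec M) {i : α → ℕ} (hi : Primrec i) :
    Primrec fun x => (M x).primePow (i x) := by
  unfold primePow
  fun_prop

theorem primrecPred_reducesTo (hM : Primrec M) {a e : α → List (List k)} (ha : Primrec a)
    (he : Primrec e) : PrimrecPred fun x => (M x).ReducesTo (a x) (e x) := by
  unfold ReducesTo
  refine primrecPred_exists_mem (by fun_prop) (primrecPred_ofCoeffs₂_eq ?_ ?_) <;> fun_prop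

theorem primrecPred_reducible (hM : Primrec M) {a : α → List (List k)} (ha : Primrec a) :
    PrimrecPred fun x => (M x).Reducible (a x) := by
  unfold Reducible
  refine primrecPred_exists_mem (by fun_prop) (primrecPred_reducesTo ?_ ?_ ?_) <;> fun_prop

theorem primrecPred_congr (hM : Primrec M) {a b : α → List (List k)} (ha : Primrec a)
    (hb : Primrec b) : PrimrecPred fun x => (M x).Congr (a x) (b x) := by
  unfold Congr
  refine primrecPred_exists_mem (by fun_prop) (.and (primrecPred_reducesTo ?_ ?_ ?_)
    (primrecPred_reducesTo ?_ ?_ ?_)) <;> fun_prop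

theorem primrecPred_isModel (κ : List k) : PrimrecPred fun M : ModelData k => M.IsModel κ := by
  unfold IsModel
  refine .and (.not (primrecPred_eq (by fun_prop) (by fun_prop))) (.and ?_ (.and ?_ ?_))
  · exact primrecPred_exists_mem (by fun_prop) (.not (primrecPred_eq (by fun_prop) (by fun_prop)))
  · refine primrecPred_forall_mem (by fun_prop) (.and (primrecPred_le (by fun_prop) (by fun_prop))
      (primrecPred_forall_mem (by fun_prop) (primrecPred_le ?_ ?_))) <;> fun_prop
  · refine primrecPred_forall_mem ?_ (primrecPred_reducible Primrec.fst Primrec.snd)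
    unfold required
    fun_prop

theorem primrecPred_isIdeal (hM : Primrec M) {L : α → List (List (List k))} (hL : Primrec L) :
    PrimrecPred fun x => (M x).IsIdeal (L x) := by
  unfold IsIdeal
  refine .and ?_ (.and ?_ (.and ?_ ?_))
  · exact primrecPred_forall_mem hL (primrecPred_mem (by fun_prop) (by fun_prop))
  · refine primrecPred_exists_mem hL (primrecPred_congr ?_ ?_ ?_) <;> fun_prop
  · refine primrecPred_forall_mem hL (primrecPred_forall_mem (by fun_prop)
      (primrecPred_exists_mem (by fun_prop) (primrecPred_congr ?_ ?_ ?_))) <;> fun_prop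
  · refine primrecPred_forall_mem (by fun_prop) (primrecPred_forall_mem (by fun_prop)
      (primrecPred_exists_mem (by fun_prop) (primrecPred_congr ?_ ?_ ?_))) <;> fun_prop

theorem primrecPred_equivalent (hM : Primrec M) {L L' : α → List (List (List k))}
    (hL : Primrec L) (hL' : Primrec L') : PrimrecPred fun x => (M x).Equivalent (L x) (L' x) := by
  unfold Equivalent
  refine primrecPred_exists_mem (by fun_prop) (primrecPred_exists_mem (by fun_prop)
    (.and ?_ (.and ?_ ?_)))
  · refine primrecPred_congr ?_ ?_ ?_ <;> fun_prop
  all_goals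
    refine primrecPred_forall_mem (by fun_prop) (primrecPred_exists_mem (by fun_prop)
      (primrecPred_congr ?_ ?_ ?_)) <;> fun_prop

theorem primrecPred_containsProduct (hM : Primrec M) {J L L' : α → List (List (List k))}
    (hJ : Primrec J) (hL : Primrec L) (hL' : Primrec L') :
    PrimrecPred fun x => (M x).ContainsProduct (J x) (L x) (L' x) := by
  unfold ContainsProduct
  refine primrecPred_forall_mem (by fun_prop) (primrecPred_forall_mem (by fun_prop)
      (primrecPred_exists_mem (by fun_prop) (primrecPred_congr ?_ ?_ ?_))) <;> fun_prop

theorem primrecPred_contained (hM : Primrec M) {J J' : α → List (List (List k))}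
    (hJ : Primrec J) (hJ' : Primrec J') :
    PrimrecPred fun x => (M x).Contained (J x) (J' x) := by
  unfold Contained
  refine primrecPred_forall_mem (by fun_prop)
      (primrecPred_exists_mem (by fun_prop) (primrecPred_congr ?_ ?_ ?_)) <;> fun_prop

theorem primrecPred_isProduct (hM : Primrec M) {J L L' : α → List (List (List k))}
    (hJ : Primrec J) (hL : Primrec L) (hL' : Primrec L') :
    PrimrecPred fun x => (M x).IsProduct (J x) (L x) (L' x) := by
  unfold IsProduct
  refine .and (primrecPred_isIdeal hM hJ) (.and (primrecPred_containsProduct hM hJ hL hL') ?_)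
  refine primrecPred_forall_mem (by fun_prop) (primrecPred_imp (primrecPred_isIdeal ?_ ?_)
    (primrecPred_imp (primrecPred_containsProduct ?_ ?_ ?_ ?_)
      (primrecPred_contained ?_ ?_ ?_))) <;> fun_prop

theorem primrecPred_certifies : PrimrecPred fun x : ModelData k ×
    List (List (List (List k))) × List (List ℕ) => x.1.Certifies x.2 := by
  unfold Certifies
  refine .and ?_ (.and ?_ (.and ?_ (.and ?_ ?_)))
  · refine primrecPred_forall_mem (by fun_prop) (.and (primrecPred_isIdeal ?_ ?_)
      (primrecPred_exists_mem ?_ (primrecPred_congr ?_ ?_ ?_))) <;> fun_prop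
  · refine primrecPred_forall_lt (by fun_prop) (primrecPred_forall_lt (by fun_prop)
      (primrecPred_imp (primrecPred_equivalent ?_ ?_ ?_) (primrecPred_eq ?_ ?_))) <;> fun_prop
  · refine primrecPred_exists_mem (by fun_prop) (primrecPred_equivalent ?_ ?_ ?_) <;> fun_prop
  · refine primrecPred_forall_mem (by fun_prop) (primrecPred_forall_mem (by fun_prop)
      (primrecPred_imp (primrecPred_isIdeal ?_ ?_) (primrecPred_imp (primrecPred_contained ?_ ?_ ?_)
        (primrecPred_imp (primrecPred_forall_mem ?_ (primrecPred_exists_mem ?_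
          (primrecPred_congr ?_ ?_ ?_))) (primrecPred_exists_mem ?_
            (primrecPred_equivalent ?_ ?_ ?_)))))) <;> fun_prop
  · refine primrecPred_forall_lt (by fun_prop) (primrecPred_forall_lt (by fun_prop)
      (primrecPred_exists_lt (by fun_prop) (.and (primrecPred_eq ?_ ?_)
        (primrecPred_exists_mem ?_ (.and (primrecPred_isProduct ?_ ?_ ?_ ?_)
          (primrecPred_equivalent ?_ ?_ ?_)))))) <;> fun_prop

end PrimitiveRecursive

end ModelData
end Certificates

/-! ### Meaning of the certificate conditions in `S / p ^ N` -/

section Powers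

namespace ModelData.Realizes

variable {k S : Type*} [CommRing S] {M : ModelData k} {p : S}

theorem pow_precision_mem {I : Ideal S} {i : ℕ} (hi : i ≤ M.precision) (hI : p ^ i ∈ I) :
    p ^ M.precision ∈ I := I.mem_of_dvd (pow_dvd_pow p hi) hI

theorem mem_of_dvd_sub {I : Ideal S} {i : ℕ} (hi : i ≤ M.precision) (hI : p ^ i ∈ I) {s t : S}
    (ht : t ∈ I) (h : p ^ M.precision ∣ s - t) : s ∈ I := by
  have := I.mem_of_dvd h (pow_precision_mem hi hI)
  simpa using add_mem this ht

/-- The level `2 * t + 1` leaves room for products, which need `2 * t`, and for neighbours, which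
need `t + 1`. The precision is the least exponent that `sameClass_iff` then allows. -/
theorem pow_idealLevel_mem_mul {I I' : Ideal S} (hI : p ^ M.level ∈ I) (hI' : p ^ M.level ∈ I') :
    p ^ M.idealLevel ∈ I * I' := by
  refine (I * I').mem_of_dvd (pow_dvd_pow p (by lia : M.level + M.level ≤ _)) ?_
  rw [pow_add]
  exact Ideal.mul_mem_mul hI hI'

end ModelData.Realizes
end Powers

section Semantics

variable {k : Type*} [Field k] {S : Type*} [CommRing S]

/-- The map `ψ` identifies the model with the ring `S / p ^ N`. -/
structure ModelData.Realizes (M : ModelData k) (p : S) (ψ : List (List k) → S) : Prop where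
  complete : FinitelyComplete p
  map_add : ∀ a b, ψ (addCoeffs₂ a b) = ψ a + ψ b
  map_mul : ∀ a b, ψ (mulCoeffs₂ a b) = ψ a * ψ b
  map_primePow : ∀ i, ψ (M.primePow i) = p ^ i
  congr_iff : ∀ {a b}, M.Reducible a → M.Reducible b →
    (M.Congr a b ↔ p ^ M.precision ∣ ψ a - ψ b)
  exists_elem : ∀ s, ∃ e ∈ M.elems, p ^ M.precision ∣ s - ψ e
  reducible : ∀ a ∈ M.elems, M.Reducible a
  reducible_add : ∀ a ∈ M.elems, ∀ b ∈ M.elems, M.Reducible (addCoeffs₂ a b)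
  reducible_mul : ∀ a ∈ M.elems, ∀ b ∈ M.elems, M.Reducible (mulCoeffs₂ a b)
  reducible_primePow : ∀ i < M.precision, M.Reducible (M.primePow i)
  reducible_primePow_mul : ∀ i < M.precision, ∀ b ∈ M.elems,
    M.Reducible (mulCoeffs₂ (M.primePow i) b)

namespace ModelData.Realizes

variable {M : ModelData k} {p : S} {ψ : List (List k) → S}

/-- The list consists of the elements of the model that lie in the ideal. -/
def Lists (M : ModelData k) (p : S) (ψ : List (List k) → S) (L : List (List (List k)))
    (I : Ideal S) : Prop :=
  (∀ a ∈ L, a ∈ M.elems) ∧ (∀ a ∈ L, ψ a ∈ I) ∧ ∀ s ∈ I, ∃ a ∈ L, p ^ M.precision ∣ s - ψ a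

theorem lists_elems (h : M.Realizes p ψ) : Lists M p ψ M.elems ⊤ :=
  ⟨fun _ ha => ha, fun _ _ => Submodule.mem_top, fun s _ => h.exists_elem s⟩

theorem exists_lists (h : M.Realizes p ψ) {I : Ideal S} {i : ℕ} (hi : i ≤ M.precision)
    (hI : p ^ i ∈ I) : ∃ L ∈ sublistsList M.elems, Lists M p ψ L I := by
  classical
  refine ⟨_, filter_mem_sublistsList M.elems fun e => decide (ψ e ∈ I), fun a ha => ?_,
    fun a ha => ?_, fun s hs => ?_⟩
  · exact (List.mem_filter.1 ha).1
  · simpa using (List.mem_filter.1 ha).2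
  · obtain ⟨e, he, hse⟩ := h.exists_elem s
    refine ⟨e, List.mem_filter.2 ⟨he, ?_⟩, hse⟩
    simpa using mem_of_dvd_sub hi hI hs (dvd_sub_comm.1 hse)

/-- The ideal is the preimage in `S` of the listed residues modulo `p ^ N`. -/
theorem lists_of_isIdeal (h : M.Realizes p ψ) {L : List (List (List k))} (hL : M.IsIdeal L) :
    ∃ I : Ideal S, p ^ M.idealLevel ∈ I ∧ Lists M p ψ L I := by
  obtain ⟨hE, ⟨a₀, ha₀, ha₀'⟩, hadd, hmul⟩ := hL
  rw [h.congr_iff (h.reducible _ (hE _ ha₀)) (h.reducible_primePow _ (by lia)), h.map_primePow]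
    at ha₀'
  have hadd' : ∀ a ∈ L, ∀ b ∈ L, ∃ c ∈ L, p ^ M.precision ∣ ψ a + ψ b - ψ c := by
    intro a ha b hb
    obtain ⟨c, hc, hc'⟩ := hadd a ha b hb
    rw [h.congr_iff (h.reducible_add _ (hE _ ha) _ (hE _ hb)) (h.reducible _ (hE _ hc)),
      h.map_add] at hc'
    exact ⟨c, hc, hc'⟩
  have hmul' : ∀ s, ∀ b ∈ L, ∃ c ∈ L, p ^ M.precision ∣ s * ψ b - ψ c := by
    intro s b hb
    obtain ⟨e, he, hse⟩ := h.exists_elem s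
    obtain ⟨c, hc, hc'⟩ := hmul e he b hb
    rw [h.congr_iff (h.reducible_mul _ he _ (hE _ hb)) (h.reducible _ (hE _ hc)),
      h.map_mul] at hc'
    refine ⟨c, hc, ?_⟩
    have : s * ψ b - ψ c = (s - ψ e) * ψ b + (ψ e * ψ b - ψ c) := by ring
    rw [this]
    exact dvd_add (hse.mul_right _) hc'
  let I : Ideal S :=
    { carrier := {s | ∃ a ∈ L, p ^ M.precision ∣ s - ψ a}
      add_mem' := by
        rintro s s' ⟨a, ha, hs⟩ ⟨b, hb, hs'⟩
        obtain ⟨c, hc, hc'⟩ := hadd' a ha b hb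
        refine ⟨c, hc, ?_⟩
        have : s + s' - ψ c = (s - ψ a) + (s' - ψ b) + (ψ a + ψ b - ψ c) := by ring
        rw [this]
        exact dvd_add (dvd_add hs hs') hc'
      zero_mem' := by
        obtain ⟨c, hc, hc'⟩ := hmul' 0 a₀ ha₀
        exact ⟨c, hc, by simpa using hc'⟩
      smul_mem' := by
        rintro r s ⟨a, ha, hs⟩
        obtain ⟨c, hc, hc'⟩ := hmul' r a ha
        refine ⟨c, hc, ?_⟩
        have : r • s - ψ c = r * (s - ψ a) + (r * ψ a - ψ c) := by rw [smul_eq_mul]; ring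
        rw [this]
        exact dvd_add (hs.mul_left _) hc' }
  refine ⟨I, ⟨a₀, ha₀, dvd_sub_comm.1 ha₀'⟩, hE, fun a ha => ⟨a, ha, by simp⟩, fun s hs => hs⟩

theorem isIdeal_of_lists (h : M.Realizes p ψ) {L : List (List (List k))} {I : Ideal S}
    (hI : p ^ M.idealLevel ∈ I) (hL : Lists M p ψ L I) : M.IsIdeal L := by
  obtain ⟨hE, hψ, hex⟩ := hL
  refine ⟨hE, ?_, fun a ha b hb => ?_, fun a ha b hb => ?_⟩
  · obtain ⟨a, ha, ha'⟩ := hex _ hI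
    refine ⟨a, ha, ?_⟩
    rw [h.congr_iff (h.reducible _ (hE _ ha)) (h.reducible_primePow _ (by lia)), h.map_primePow]
    exact dvd_sub_comm.1 ha'
  · obtain ⟨c, hc, hc'⟩ := hex _ (add_mem (hψ a ha) (hψ b hb))
    refine ⟨c, hc, ?_⟩
    rwa [h.congr_iff (h.reducible_add _ (hE _ ha) _ (hE _ hb)) (h.reducible _ (hE _ hc)),
      h.map_add]
  · obtain ⟨c, hc, hc'⟩ := hex _ (I.mul_mem_left (ψ a) (hψ b hb))
    refine ⟨c, hc, ?_⟩
    rwa [h.congr_iff (h.reducible_mul _ ha _ (hE _ hb)) (h.reducible _ (hE _ hc)),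
      h.map_mul]

theorem contained_iff (h : M.Realizes p ψ) {L L' : List (List (List k))} {I I' : Ideal S}
    {i : ℕ} (hi : i ≤ M.precision) (hI' : p ^ i ∈ I') (hL : Lists M p ψ L I)
    (hL' : Lists M p ψ L' I') : M.Contained L L' ↔ I ≤ I' := by
  constructor
  · intro hc s hs
    obtain ⟨a, ha, hsa⟩ := hL.2.2 s hs
    obtain ⟨b, hb, hab⟩ := hc a ha
    rw [h.congr_iff (h.reducible _ (hL.1 _ ha)) (h.reducible _ (hL'.1 _ hb))] at hab
    exact mem_of_dvd_sub hi hI' (mem_of_dvd_sub hi hI' (hL'.2.1 b hb) hab) hsa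
  · intro hle a ha
    obtain ⟨b, hb, hab⟩ := hL'.2.2 _ (hle (hL.2.1 a ha))
    exact ⟨b, hb, (h.congr_iff (h.reducible _ (hL.1 _ ha)) (h.reducible _ (hL'.1 _ hb))).2 hab⟩

/-- In the criterion `sameClass_iff` all elements matter only modulo `p ^ N`, so the witnesses may
be taken from the model. -/
theorem equivalent_iff (h : M.Realizes p ψ) {L L' : List (List (List k))} {I I' : Ideal S}
    (hI : p ^ M.idealLevel ∈ I) (hI' : p ^ M.idealLevel ∈ I') (hL : Lists M p ψ L I)
    (hL' : Lists M p ψ L' I') : M.Equivalent L L' ↔ SameClass I I' := by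
  rw [h.complete.sameClass_iff (N := M.precision) hI hI' (by lia)]
  have key : ∀ {L L' : List (List (List k))} {I I' : Ideal S}, Lists M p ψ L I →
      Lists M p ψ L' I' → p ^ M.idealLevel ∈ I' → ∀ {y : S} {e}, e ∈ M.elems →
      p ^ M.precision ∣ y - ψ e → ((∀ a ∈ L, ∃ b ∈ L', M.Congr (mulCoeffs₂ e a)
        (mulCoeffs₂ (M.primePow M.idealLevel) b)) ↔
      ∀ a ∈ I, ∃ b ∈ I', p ^ M.precision ∣ y * a - p ^ M.idealLevel * b) := by
    intro L L' I I' hL hL' hI' y e he hye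
    constructor
    · intro hc s hs
      obtain ⟨a, ha, hsa⟩ := hL.2.2 s hs
      obtain ⟨b, hb, hab⟩ := hc a ha
      rw [h.congr_iff (h.reducible_mul _ he _ (hL.1 _ ha))
        (h.reducible_primePow_mul _ (by lia) _ (hL'.1 _ hb)), h.map_mul, h.map_mul,
        h.map_primePow] at hab
      refine ⟨ψ b, hL'.2.1 b hb, ?_⟩
      have : y * s - p ^ M.idealLevel * ψ b =
          (y - ψ e) * s + ψ e * (s - ψ a) + (ψ e * ψ a - p ^ M.idealLevel * ψ b) := by ring
      rw [this]
      exact dvd_add (dvd_add (hye.mul_right _) (hsa.mul_left _)) hab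
    · intro hc a ha
      obtain ⟨s, hs, has⟩ := hc _ (hL.2.1 a ha)
      obtain ⟨b, hb, hsb⟩ := hL'.2.2 s hs
      refine ⟨b, hb, ?_⟩
      rw [h.congr_iff (h.reducible_mul _ he _ (hL.1 _ ha))
        (h.reducible_primePow_mul _ (by lia) _ (hL'.1 _ hb)), h.map_mul, h.map_mul,
        h.map_primePow]
      have : ψ e * ψ a - p ^ M.idealLevel * ψ b = (y * ψ a - p ^ M.idealLevel * s) -
          (y - ψ e) * ψ a + p ^ M.idealLevel * (s - ψ b) := by ring
      rw [this]
      exact dvd_add (dvd_sub has (hye.mul_right _)) (hsb.mul_left _)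
  have key' : ∀ {y z e e'}, e ∈ M.elems → e' ∈ M.elems → p ^ M.precision ∣ y - ψ e →
      p ^ M.precision ∣ z - ψ e' → (M.Congr (mulCoeffs₂ e e') (M.primePow (2 * M.idealLevel)) ↔
        p ^ M.precision ∣ y * z - p ^ (2 * M.idealLevel)) := by
    intro y z e e' he he' hy hz
    rw [h.congr_iff (h.reducible_mul _ he _ he') (h.reducible_primePow _ (by lia)), h.map_mul,
      h.map_primePow]
    refine (dvd_iff_dvd_of_dvd_sub ?_).symm
    have : y * z - p ^ (2 * M.idealLevel) - (ψ e * ψ e' - p ^ (2 * M.idealLevel)) =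
      (y - ψ e) * z + ψ e * (z - ψ e') := by ring
    rw [this]
    exact dvd_add (hy.mul_right _) (hz.mul_left _)
  constructor
  · rintro ⟨e, he, e', he', h1, h2, h3⟩
    exact ⟨ψ e, ψ e', (key' he he' (by simp) (by simp)).1 h1,
      (key hL hL' hI' he (by simp)).1 h2, (key hL' hL hI he' (by simp)).1 h3⟩
  · rintro ⟨y, z, h1, h2, h3⟩
    obtain ⟨e, he, hy⟩ := h.exists_elem y
    obtain ⟨e', he', hz⟩ := h.exists_elem z
    exact ⟨e, he, e', he', (key' he he' hy hz).2 h1, (key hL hL' hI' he hy).2 h2,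
      (key hL' hL hI he' hz).2 h3⟩

theorem containsProduct_iff (h : M.Realizes p ψ) {J L L' : List (List (List k))}
    {K I I' : Ideal S} (hK : p ^ M.idealLevel ∈ K) (hJ : Lists M p ψ J K) (hL : Lists M p ψ L I)
    (hL' : Lists M p ψ L' I') : M.ContainsProduct J L L' ↔ I * I' ≤ K := by
  have hlev : M.idealLevel ≤ M.precision := by lia
  constructor
  · intro hc
    refine Ideal.mul_le.2 fun s hs s' hs' => ?_
    obtain ⟨a, ha, hsa⟩ := hL.2.2 s hs
    obtain ⟨b, hb, hsb⟩ := hL'.2.2 s' hs'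
    obtain ⟨c, hc, hc'⟩ := hc a ha b hb
    rw [h.congr_iff (h.reducible_mul _ (hL.1 _ ha) _ (hL'.1 _ hb)) (h.reducible _ (hJ.1 _ hc)),
      h.map_mul] at hc'
    refine mem_of_dvd_sub hlev hK (hJ.2.1 c hc) ?_
    have : s * s' - ψ c = (s - ψ a) * s' + ψ a * (s' - ψ b) + (ψ a * ψ b - ψ c) := by ring
    rw [this]
    exact dvd_add (dvd_add (hsa.mul_right _) (hsb.mul_left _)) hc'
  · intro hle a ha b hb
    obtain ⟨c, hc, hc'⟩ := hJ.2.2 _ (hle (Ideal.mul_mem_mul (hL.2.1 a ha) (hL'.2.1 b hb)))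
    refine ⟨c, hc, ?_⟩
    rwa [h.congr_iff (h.reducible_mul _ (hL.1 _ ha) _ (hL'.1 _ hb)) (h.reducible _ (hJ.1 _ hc)),
      h.map_mul]

/-- `IsProduct` describes the least ideal of the model that contains all products. The true product
contains `p ^ M.idealLevel`, so it is among the competitors. -/
theorem lists_mul_of_isProduct (h : M.Realizes p ψ) {J L L' : List (List (List k))}
    {I I' : Ideal S} (hI : p ^ M.level ∈ I) (hI' : p ^ M.level ∈ I') (hL : Lists M p ψ L I)
    (hL' : Lists M p ψ L' I') (hJ : M.IsProduct J L L') : Lists M p ψ J (I * I') := by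
  have hlev : M.idealLevel ≤ M.precision := by lia
  obtain ⟨hJ, hprod, hmin⟩ := hJ
  obtain ⟨K, hK, hJK⟩ := h.lists_of_isIdeal hJ
  have hII := pow_idealLevel_mem_mul hI hI'
  obtain ⟨J', hJ', hJ'II⟩ := h.exists_lists hlev hII
  have h1 := hmin J' hJ' (h.isIdeal_of_lists hII hJ'II)
    ((h.containsProduct_iff hII hJ'II hL hL').2 le_rfl)
  rw [h.contained_iff hlev hII hJK hJ'II] at h1
  rwa [← le_antisymm h1 ((h.containsProduct_iff hK hJK hL hL').1 hprod)]

theorem isProduct_of_lists_mul (h : M.Realizes p ψ) {J L L' : List (List (List k))}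
    {I I' : Ideal S} (hI : p ^ M.level ∈ I) (hI' : p ^ M.level ∈ I') (hL : Lists M p ψ L I)
    (hL' : Lists M p ψ L' I') (hJ : Lists M p ψ J (I * I')) : M.IsProduct J L L' := by
  have hII := pow_idealLevel_mem_mul hI hI'
  refine ⟨h.isIdeal_of_lists hII hJ, (h.containsProduct_iff hII hJ hL hL').2 le_rfl,
    fun J' _ hJ' hprod => ?_⟩
  obtain ⟨K, hK, hJK⟩ := h.lists_of_isIdeal hJ'
  rw [h.contained_iff (by lia : M.idealLevel ≤ _) hK hJ hJK]
  exact (h.containsProduct_iff hK hJK hL hL').1 hprod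

theorem pow_level_mem_iff (h : M.Realizes p ψ) {L : List (List (List k))} {I : Ideal S}
    (hI : p ^ M.idealLevel ∈ I) (hL : Lists M p ψ L I) :
    (∃ a ∈ L, M.Congr a (M.primePow M.level)) ↔ p ^ M.level ∈ I := by
  constructor
  · rintro ⟨a, ha, hc⟩
    rw [h.congr_iff (h.reducible _ (hL.1 _ ha)) (h.reducible_primePow _ (by lia)),
      h.map_primePow] at hc
    exact mem_of_dvd_sub (M := M) (by lia) hI (hL.2.1 a ha) (dvd_sub_comm.1 hc)
  · intro hm
    obtain ⟨a, ha, hc⟩ := hL.2.2 _ hm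
    refine ⟨a, ha, ?_⟩
    rw [h.congr_iff (h.reducible _ (hL.1 _ ha)) (h.reducible_primePow _ (by lia)),
      h.map_primePow]
    exact dvd_sub_comm.1 hc

theorem primePow_one_mul_iff (h : M.Realizes p ψ) {L J : List (List (List k))} {I K : Ideal S}
    (hK : p ^ M.idealLevel ∈ K) (hL : Lists M p ψ L I) (hJ : Lists M p ψ J K) :
    (∀ a ∈ L, ∃ b ∈ J, M.Congr (mulCoeffs₂ (M.primePow 1) a) b) ↔ ∀ s ∈ I, p * s ∈ K := by
  constructor
  · intro hc s hs
    obtain ⟨a, ha, hsa⟩ := hL.2.2 s hs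
    obtain ⟨b, hb, hab⟩ := hc a ha
    rw [h.congr_iff (h.reducible_primePow_mul _ (by lia) _ (hL.1 _ ha))
      (h.reducible _ (hJ.1 _ hb)), h.map_mul, h.map_primePow, pow_one] at hab
    refine mem_of_dvd_sub (M := M) (by lia) hK (hJ.2.1 b hb) ?_
    have : p * s - ψ b = p * (s - ψ a) + (p * ψ a - ψ b) := by ring
    rw [this]
    exact dvd_add (hsa.mul_left _) hab
  · intro hc a ha
    obtain ⟨b, hb, hab⟩ := hJ.2.2 _ (hc _ (hL.2.1 a ha))
    refine ⟨b, hb, ?_⟩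
    rwa [h.congr_iff (h.reducible_primePow_mul _ (by lia) _ (hL.1 _ ha))
      (h.reducible _ (hJ.1 _ hb)), h.map_mul, h.map_primePow, pow_one]

/-- A priori the listed elements generate `I` only modulo `p ^ N`. But one of them is congruent to
`p ^ t` with `t < N`, hence is `p ^ t` times a unit, so their span already contains `p ^ N`. -/
theorem span_eq_of_lists (h : M.Realizes p ψ) {L : List (List (List k))} {I : Ideal S}
    (hI : p ^ M.level ∈ I) (hL : Lists M p ψ L I) : Ideal.span {s | ∃ a ∈ L, s = ψ a} = I := by
  refine le_antisymm (Ideal.span_le.2 ?_) fun s hs => ?_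
  · rintro _ ⟨a, ha, rfl⟩
    exact hL.2.1 a ha
  · have hmem : ∀ a ∈ L, ψ a ∈ Ideal.span {s | ∃ a ∈ L, s = ψ a} := fun a ha =>
      Ideal.subset_span ⟨a, ha, rfl⟩
    obtain ⟨a, ha, c, hc⟩ := hL.2.2 _ hI
    have hpow : p ^ M.level ∈ Ideal.span {s | ∃ a ∈ L, s = ψ a} := by
      obtain ⟨u, hu⟩ := h.complete.isUnit_one_add_mul (-(p ^ (M.precision - M.level - 1) * c))
      rw [← Ideal.mul_unit_mem_iff_mem _ u.isUnit]
      have : p ^ M.level * ↑u = ψ a := by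
        have he : M.precision = M.level + 1 + (M.precision - M.level - 1) := by lia
        rw [he, pow_add, pow_succ] at hc
        rw [hu]
        linear_combination hc
      rw [this]
      exact hmem a ha
    obtain ⟨b, hb, hsb⟩ := hL.2.2 s hs
    exact mem_of_dvd_sub (M := M) (by lia) hpow (hmem b hb) hsb

end ModelData.Realizes
end Semantics

/-! ### Correctness and existence of certificates -/

section Certification

variable {k : Type*} [Field k] {S : Type*} [CommRing S] {M : ModelData k} {p : S}
  {ψ : List (List k) → S}

namespace ModelData.Realizes

/-- A certified output lists representatives of all ideal classes and their products. -/
theorem exists_equiv_of_certifies (h : M.Realizes p ψ)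
    {out : List (List (List (List k))) × List (List ℕ)} (hout : M.Certifies out) :
    ∃ e : Fin out.1.length ≃ ICM S,
      (∀ i, ∃ hI, classOfIdeal (Ideal.span {s | ∃ a ∈ out.1.get i, s = ψ a}) hI = e i) ∧
      ∀ i j : Fin out.1.length, ∃ m : Fin out.1.length,
        (∃ row, out.2[(i : ℕ)]? = some row ∧ row[(j : ℕ)]? = some (m : ℕ)) ∧ e i * e j = e m := by
  obtain ⟨hideal, hinj, ⟨L₀, hL₀, htop⟩, hclosed, htable⟩ := hout
  have hget : ∀ i : Fin out.1.length, out.1.getD i [] = out.1.get i := fun i => by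
    simp [List.getD_eq_getElem?_getD]
  have hex : ∀ i : Fin out.1.length, ∃ I : Ideal S,
      p ^ M.level ∈ I ∧ Lists M p ψ (out.1.get i) I := by
    intro i
    obtain ⟨h1, h2⟩ := hideal _ (List.get_mem out.1 i)
    obtain ⟨I, hI, hL⟩ := h.lists_of_isIdeal h1
    exact ⟨I, (h.pow_level_mem_iff hI hL).1 h2, hL⟩
  choose I hI hL using hex
  have hI' : ∀ i, p ^ M.idealLevel ∈ I i := fun i =>
    (I i).mem_of_dvd (pow_dvd_pow p (by lia)) (hI i)
  have hreg : ∀ i, ∃ x ∈ I i, x ∈ nonZeroDivisors S := fun i =>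
    h.complete.exists_mem_nonZeroDivisors (hI i)
  have hbij : Function.Bijective fun i => classOfIdeal (I i) (hreg i) := by
    constructor
    · intro i j hij
      have := (classOfIdeal_eq_iff (hreg i) (hreg j)).1 hij
      rw [← h.equivalent_iff (hI' i) (hI' j) (hL i) (hL j), ← hget, ← hget] at this
      exact Fin.ext (hinj i i.2 j j.2 this)
    · intro c
      obtain ⟨J, hJ, rfl⟩ := exists_classOfIdeal_eq c
      obtain ⟨n, hn⟩ := h.complete.exists_pow_mem hJ
      obtain ⟨_, ⟨i, rfl⟩, hi⟩ : ∃ L ∈ Set.range I, SameClass L J := by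
        refine FinitelyComplete.exists_sameClass_of_neighbours ?_ ?_ hn
        · obtain ⟨i, rfl⟩ := List.get_of_mem hL₀
          exact ⟨_, ⟨i, rfl⟩,
            (h.equivalent_iff (hI' i) Submodule.mem_top (hL i) h.lists_elems).1 htop⟩
        · rintro _ ⟨i, rfl⟩ K hK hpK
          have hK' : p ^ M.idealLevel ∈ K := by
            -- Here the summand `1` in the ideal level is needed, in case the level is zero.
            refine K.mem_of_dvd (pow_dvd_pow p (by lia : M.level + 1 ≤ _)) ?_
            rw [pow_succ']
            exact hpK _ (hI i)
          obtain ⟨L, hLs, hLK⟩ := h.exists_lists (by lia) hK'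
          obtain ⟨L', hL', heq⟩ := hclosed _ (List.get_mem out.1 i) L hLs
            (h.isIdeal_of_lists hK' hLK)
            ((h.contained_iff (by lia : M.idealLevel ≤ _) (hI' i) hLK (hL i)).2 hK)
            ((h.primePow_one_mul_iff hK' (hL i) hLK).2 hpK)
          obtain ⟨j, rfl⟩ := List.get_of_mem hL'
          exact ⟨_, ⟨j, rfl⟩, (h.equivalent_iff (hI' j) hK' (hL j) hLK).1 heq⟩
      exact ⟨i, (classOfIdeal_eq_iff _ _).2 hi⟩
  refine ⟨Equiv.ofBijective _ hbij, fun i => ?_, fun i j => ?_⟩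
  · have := h.span_eq_of_lists (hI i) (hL i)
    rw [this]
    exact ⟨hreg i, rfl⟩
  · obtain ⟨r, hr, hrow, J, -, hJ, heq⟩ := htable i i.2 j j.2
    refine ⟨⟨r, hr⟩, ⟨out.2.getD i [], ?_, hrow⟩, ?_⟩
    · by_cases hi : (i : ℕ) < out.2.length
      · simp [List.getD_eq_getElem?_getD, hi]
      · rw [List.getD_eq_default _ _ (by simpa using hi)] at hrow
        simp at hrow
    · rw [hget i, hget j] at hJ
      have hr' : out.1.getD r [] = out.1.get ⟨r, hr⟩ := hget ⟨r, hr⟩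
      rw [hr'] at heq
      have hmem := pow_idealLevel_mem_mul (hI i) (hI j)
      have hJ' := h.lists_mul_of_isProduct (hI i) (hI j) (hL i) (hL j) hJ
      rw [h.equivalent_iff (hI' _) hmem (hL _) hJ'] at heq
      change classOfIdeal _ _ * classOfIdeal _ _ = classOfIdeal _ _
      rw [classOfIdeal_mul _ _ (h.complete.exists_mem_nonZeroDivisors hmem)]
      exact (classOfIdeal_eq_iff _ _).2 heq.symm

/-- One representative containing `p ^ M.level` is chosen for each class. The closure condition then
holds because every class is represented. -/
theorem exists_certifies (h : M.Realizes p ψ) (hlevel : ∀ (I : Ideal S) (n : ℕ), p ^ n ∈ I →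
    ∃ J, p ^ M.level ∈ J ∧ SameClass I J) : ∃ out, M.Certifies out := by
  have := h.complete.finite_ICM hlevel
  have hex : ∀ c : ICM S, ∃ (I : Ideal S) (hI : ∃ x ∈ I, x ∈ nonZeroDivisors S),
      p ^ M.level ∈ I ∧ classOfIdeal I hI = c := by
    intro c
    obtain ⟨J, hJ, rfl⟩ := exists_classOfIdeal_eq c
    obtain ⟨n, hn⟩ := h.complete.exists_pow_mem hJ
    obtain ⟨I, hI, hJI⟩ := hlevel J n hn
    exact ⟨I, h.complete.exists_mem_nonZeroDivisors hI, hI, (classOfIdeal_eq_iff _ _).2 hJI.symm⟩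
  choose I hreg hI hc using hex
  have hI' : ∀ c, p ^ M.idealLevel ∈ I c := fun c =>
    (I c).mem_of_dvd (pow_dvd_pow p (by lia)) (hI c)
  have hlist := fun c => h.exists_lists (by lia : M.level ≤ M.precision) (hI c)
  choose L hLs hL using hlist
  have hsame : ∀ {J : Ideal S} {n : ℕ}, p ^ n ∈ J → ∃ c, SameClass (I c) J := by
    intro J n hn
    have hJ := h.complete.exists_mem_nonZeroDivisors hn
    exact ⟨classOfIdeal J hJ, (classOfIdeal_eq_iff (hreg _) hJ).1 (hc _)⟩
  obtain ⟨n, ⟨e⟩⟩ := Finite.exists_equiv_fin (ICM S)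
  have hmemL : ∀ c, L c ∈ List.ofFn fun i => L (e.symm i) := fun c =>
    List.mem_ofFn.2 ⟨e c, by simp⟩
  have hgetL : ∀ i < n, ∃ c, (List.ofFn fun i => L (e.symm i)).getD i [] = L c ∧ (e c : ℕ) = i :=
    fun i hi => ⟨e.symm ⟨i, hi⟩, by simp [List.getD_eq_getElem?_getD, hi], by simp⟩
  refine ⟨(List.ofFn fun i => L (e.symm i),
    List.ofFn fun i => List.ofFn fun j => (e (e.symm i * e.symm j) : ℕ)), ?_, ?_, ?_, ?_, ?_⟩
  · intro l hl
    obtain ⟨i, rfl⟩ := List.mem_ofFn.1 hl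
    exact ⟨h.isIdeal_of_lists (hI' _) (hL _), (h.pow_level_mem_iff (hI' _) (hL _)).2 (hI _)⟩
  · intro i hi j hj hij
    simp only [List.length_ofFn] at hi hj
    obtain ⟨c, hci, rfl⟩ := hgetL i hi
    obtain ⟨d, hdj, rfl⟩ := hgetL j hj
    simp only [hci, hdj] at hij
    rw [h.equivalent_iff (hI' c) (hI' d) (hL c) (hL d)] at hij
    rw [← hc c, ← hc d, (classOfIdeal_eq_iff (hreg c) (hreg d)).2 hij]
  · obtain ⟨c, hc⟩ := hsame (J := ⊤) (n := 0) Submodule.mem_top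
    exact ⟨L c, hmemL c, (h.equivalent_iff (hI' c) Submodule.mem_top (hL c) h.lists_elems).2 hc⟩
  · intro _ _ J _ hJ _ _
    obtain ⟨K, hK, hJK⟩ := h.lists_of_isIdeal hJ
    obtain ⟨c, hc⟩ := hsame hK
    exact ⟨L c, hmemL c, (h.equivalent_iff (hI' c) hK (hL c) hJK).2 hc⟩
  · intro i hi j hj
    simp only [List.length_ofFn] at hi hj ⊢
    obtain ⟨c, hci, rfl⟩ := hgetL i hi
    obtain ⟨d, hdj, rfl⟩ := hgetL j hj
    have hmem := pow_idealLevel_mem_mul (hI c) (hI d)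
    obtain ⟨J, hJs, hJ⟩ := h.exists_lists (by lia) hmem
    refine ⟨e (c * d), (e (c * d)).2, ?_, J, hJs, ?_, ?_⟩
    · simp [List.getD_eq_getElem?_getD]
    · rw [hci, hdj]
      exact h.isProduct_of_lists_mul (hI c) (hI d) (hL c) (hL d) hJ
    · obtain ⟨m, hm, hm'⟩ := hgetL (e (c * d)) (e (c * d)).2
      obtain rfl : m = c * d := e.injective (Fin.ext hm')
      rw [hm, h.equivalent_iff (hI' _) hmem (hL _) hJ,
        ← classOfIdeal_eq_iff (hreg _) (h.complete.exists_mem_nonZeroDivisors hmem), hc,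
        ← classOfIdeal_mul (hreg c) (hreg d), hc, hc]

end ModelData.Realizes
end Certification

/-! ### Models of the completed order of a curve -/

section Realization

variable {k : Type*} [Field k]

/-- The element of the completed order that is given by a list of coefficients. -/
noncomputable def completedElement (f : k[X][X]) (P : k[X]) (a : List (List k)) :
    CompletedOrder f P :=
  algebraMap (AdjoinRoot f) (CompletedOrder f P) (AdjoinRoot.mk f (ofCoeffs₂ a))

theorem completedIdeal_map_ofCoeffs₂ (f : k[X][X]) (P : k[X]) (L : List (List (List k))) :
    completedIdeal f P (L.map ofCoeffs₂) = Ideal.span {s | ∃ a ∈ L, s = completedElement f P a} := by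
  simp only [completedIdeal, List.mem_map, exists_exists_and_eq_and, completedElement]

theorem completedPrime_pow_dvd_iff (f : k[X][X]) (P : k[X]) (n : ℕ) (r : AdjoinRoot f) :
    completedPrime f P ^ n ∣ algebraMap (AdjoinRoot f) (CompletedOrder f P) r ↔
      algebraMap k[X] (AdjoinRoot f) (P ^ n) ∣ r := by
  rw [map_pow]
  exact adicCompletion_pow_dvd_algebraMap_iff (IsCurve.map_span_eq f P) n r

namespace ModelData

variable {M : ModelData k} {κ : List k}

theorem ReducesTo.dvd_sub {a e : List (List k)} (h : M.ReducesTo a e) :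
    algebraMap k[X] (AdjoinRoot (ofCoeffs₂ M.poly)) (ofCoeffs M.prime ^ M.precision) ∣
      AdjoinRoot.mk (ofCoeffs₂ M.poly) (ofCoeffs₂ a) -
        AdjoinRoot.mk (ofCoeffs₂ M.poly) (ofCoeffs₂ e) := by
  obtain ⟨w, -, hw⟩ := h
  rw [hw, ofCoeffs₂_addCoeffs₂, ofCoeffs₂_addCoeffs₂, ofCoeffs₂_mulCoeffs₂, ofCoeffs₂_mulCoeffs₂,
    primePow, ofCoeffs₂_singleton, ofCoeffs_powCoeffs]
  simp only [map_add, map_mul, AdjoinRoot.mk_self, mul_zero, zero_add, add_sub_cancel_left]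
  exact Dvd.intro_left _ rfl

theorem ReducesTo.of_eq {a e e' : List (List k)} (h : M.ReducesTo a e)
    (he : ofCoeffs₂ e = ofCoeffs₂ e') : M.ReducesTo a e' := by
  obtain ⟨w, hw, hw'⟩ := h
  refine ⟨w, hw, ?_⟩
  rwa [ofCoeffs₂_addCoeffs₂, ← he, ← ofCoeffs₂_addCoeffs₂]

/-- The elements of a model represent all elements modulo the power of the prime. -/
theorem IsModel.exists_elem (hκ : ∀ c, c ∈ κ) (hM : M.IsModel κ) (g : k[X][X]) :
    ∃ e ∈ M.elems, algebraMap k[X] (AdjoinRoot (ofCoeffs₂ M.poly))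
      (ofCoeffs M.prime ^ M.precision) ∣ AdjoinRoot.mk (ofCoeffs₂ M.poly) g -
        AdjoinRoot.mk (ofCoeffs₂ M.poly) (ofCoeffs₂ e) := by
  have hreq : ∀ a ∈ M.required κ, ∃ e ∈ M.elems, algebraMap k[X] (AdjoinRoot (ofCoeffs₂ M.poly))
      (ofCoeffs M.prime ^ M.precision) ∣ AdjoinRoot.mk (ofCoeffs₂ M.poly) (ofCoeffs₂ a) -
        AdjoinRoot.mk (ofCoeffs₂ M.poly) (ofCoeffs₂ e) := by
    intro a ha
    obtain ⟨e, he, h⟩ := hM.2.2.2 a ha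
    exact ⟨e, he, h.dvd_sub⟩
  generalize algebraMap k[X] (AdjoinRoot (ofCoeffs₂ M.poly)) (ofCoeffs M.prime ^ M.precision) = Q
    at hreq ⊢
  generalize AdjoinRoot.mk (ofCoeffs₂ M.poly) = q at hreq ⊢
  have hadd : ∀ g g' : k[X][X], (∃ e ∈ M.elems, Q ∣ q g - q (ofCoeffs₂ e)) →
      (∃ e ∈ M.elems, Q ∣ q g' - q (ofCoeffs₂ e)) →
      ∃ e ∈ M.elems, Q ∣ q (g + g') - q (ofCoeffs₂ e) := by
    rintro g g' ⟨e, he, h⟩ ⟨e', he', h'⟩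
    obtain ⟨d, hd, hd'⟩ := hreq (addCoeffs₂ e e') (by
      simp only [required, List.mem_append, List.mem_flatMap, List.mem_map]
      grind)
    refine ⟨d, hd, ?_⟩
    rw [ofCoeffs₂_addCoeffs₂, map_add] at hd'
    rw [map_add]
    convert dvd_add (dvd_add h h') hd' using 1
    ring
  have hmul : ∀ g g' : k[X][X], (∃ e ∈ M.elems, Q ∣ q g - q (ofCoeffs₂ e)) →
      (∃ e ∈ M.elems, Q ∣ q g' - q (ofCoeffs₂ e)) →
      ∃ e ∈ M.elems, Q ∣ q (g * g') - q (ofCoeffs₂ e) := by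
    rintro g g' ⟨e, he, h⟩ ⟨e', he', h'⟩
    obtain ⟨d, hd, hd'⟩ := hreq (mulCoeffs₂ e e') (by
      simp only [required, List.mem_append, List.mem_flatMap, List.mem_map]
      grind)
    refine ⟨d, hd, ?_⟩
    rw [ofCoeffs₂_mulCoeffs₂, map_mul] at hd'
    rw [map_mul]
    convert dvd_add (dvd_add (h.mul_right (q g')) (h'.mul_left (q (ofCoeffs₂ e)))) hd' using 1
    ring
  have hconst : ∀ c : k, ∃ e ∈ M.elems,
      Q ∣ q (Polynomial.C (Polynomial.C c)) - q (ofCoeffs₂ e) := by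
    intro c
    have := hreq [[c]] (by simp [required, hκ c])
    simpa [ofCoeffs₂, ofCoeffs] using this
  have hT : ∃ e ∈ M.elems, Q ∣ q (Polynomial.C Polynomial.X) - q (ofCoeffs₂ e) := by
    have := hreq [[0, 1]] (by simp [required])
    simpa [ofCoeffs₂, ofCoeffs] using this
  have hX : ∃ e ∈ M.elems, Q ∣ q Polynomial.X - q (ofCoeffs₂ e) := by
    have := hreq [[], [1]] (by simp [required])
    simpa [ofCoeffs₂, ofCoeffs] using this
  -- The represented polynomials are closed under sums and products and contain the constants, `T`
  -- and `x`.
  induction g using Polynomial.induction_on with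
  | C a =>
    induction a using Polynomial.induction_on with
    | C c => exact hconst c
    | add a b ha hb =>
      rw [map_add]
      exact hadd _ _ ha hb
    | monomial n c h =>
      rw [pow_succ, ← mul_assoc, map_mul]
      exact hmul _ _ h hT
  | add a b ha hb => exact hadd _ _ ha hb
  | monomial n c h =>
    rw [pow_succ, ← mul_assoc]
    exact hmul _ _ h hX

theorem IsModel.realizes [Finite k] (hκ : ∀ c, c ∈ κ) (hM : M.IsModel κ)
    (hf : IsCurve (ofCoeffs₂ M.poly)) (hP : ofCoeffs M.prime ≠ 0) :
    M.Realizes (completedPrime (ofCoeffs₂ M.poly) (ofCoeffs M.prime))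
      (completedElement (ofCoeffs₂ M.poly) (ofCoeffs M.prime)) := by
  have hreq := hM.2.2.2
  simp only [required, List.mem_append, List.mem_flatMap, List.mem_map, List.mem_range] at hreq
  have hdvd : ∀ a b, completedPrime (ofCoeffs₂ M.poly) (ofCoeffs M.prime) ^ M.precision ∣
      completedElement (ofCoeffs₂ M.poly) (ofCoeffs M.prime) a -
        completedElement (ofCoeffs₂ M.poly) (ofCoeffs M.prime) b ↔
      algebraMap k[X] (AdjoinRoot (ofCoeffs₂ M.poly)) (ofCoeffs M.prime ^ M.precision) ∣
      AdjoinRoot.mk (ofCoeffs₂ M.poly) (ofCoeffs₂ a) -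
        AdjoinRoot.mk (ofCoeffs₂ M.poly) (ofCoeffs₂ b) := by
    intro a b
    rw [← completedPrime_pow_dvd_iff, map_sub]
    rfl
  have hn : M.polyDeg ≤ (ofCoeffs₂ M.poly).natDegree := by
    refine Polynomial.le_natDegree_of_ne_zero ?_
    obtain ⟨c, hc, hc0⟩ := hM.2.1
    obtain ⟨i, hi, rfl⟩ := List.getElem_of_mem hc
    intro h0
    rw [ofCoeffs₂, coeff_ofCoeffs, getD_map_of_eq (z := []) rfl] at h0
    have := congrArg (fun g => Polynomial.coeff g i) h0
    simp only [coeff_ofCoeffs, Polynomial.coeff_zero] at this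
    rw [List.getD_eq_getElem _ _ hi] at this
    exact hc0 this
  have hd : M.primeDeg * M.precision ≤ (ofCoeffs M.prime ^ M.precision).natDegree := by
    rw [Polynomial.natDegree_pow, mul_comm]
    refine Nat.mul_le_mul_left _ (Polynomial.le_natDegree_of_ne_zero ?_)
    rw [coeff_ofCoeffs]
    exact hM.1
  refine ⟨hf.finitelyComplete hP, fun a b => ?_, fun a b => ?_, fun i => ?_, fun {a b} ha hb => ?_,
    fun s => ?_, fun a ha => hreq a ?_, fun a ha b hb => hreq _ ?_, fun a ha b hb => hreq _ ?_,
    fun i hi => hreq _ ?_, fun i hi b hb => hreq _ ?_⟩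
  · simp only [completedElement, ofCoeffs₂_addCoeffs₂, map_add]
  · simp only [completedElement, ofCoeffs₂_mulCoeffs₂, map_mul]
  · rw [completedElement, primePow, ofCoeffs₂_singleton, ofCoeffs_powCoeffs, map_pow, map_pow,
      map_pow]
    rfl
  · rw [hdvd]
    constructor
    · rintro ⟨e, -, hae, hbe⟩
      simpa using dvd_sub hae.dvd_sub hbe.dvd_sub
    · intro hab
      obtain ⟨e, he, hae⟩ := ha
      obtain ⟨e', he', hbe⟩ := hb
      -- The two reductions need only agree as polynomials, not as lists, and this follows from
      -- uniqueness of normal forms.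
      refine ⟨e, he, hae, hbe.of_eq ?_⟩
      refine hf.eq_of_dvd_sub hn hd (hM.2.2.1 e' he') (hM.2.2.1 e he) ?_
      convert dvd_sub (dvd_sub hae.dvd_sub hbe.dvd_sub) hab using 1
      ring
  · obtain ⟨r, hr⟩ := adicCompletion_exists_pow_dvd_sub (IsCurve.map_span_eq _ _) M.precision s
    obtain ⟨g, rfl⟩ := AdjoinRoot.mk_surjective r
    obtain ⟨e, he, h⟩ := hM.exists_elem hκ g
    refine ⟨e, he, ?_⟩
    rw [← completedPrime_pow_dvd_iff, map_sub] at h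
    have := dvd_add hr h
    rw [sub_add_sub_cancel] at this
    exact this
  all_goals grind

theorem exists_isModel [Finite k] {cf : List (List k)} {cP : List k} (hf : IsCurve (ofCoeffs₂ cf))
    (hP : ofCoeffs cP ≠ 0) (κ : List k) (t : ℕ) :
    ∃ M : ModelData k, M.1 = (cf, cP) ∧ M.level = t ∧ M.IsModel κ := by
  let N := 2 * (2 * t + 1) + 1
  have hfin := finite_isReduced (κ := k) (ofCoeffs₂ cf).natDegree ((ofCoeffs cP).natDegree * N)
  let elems := hfin.toFinset.toList
  have helems : ∀ l, l ∈ elems ↔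
      IsReduced (ofCoeffs₂ cf).natDegree ((ofCoeffs cP).natDegree * N) l := by simp [elems]
  have hex : ∀ a : List (List k), ∃ w : List (List k) × List (List k), ∃ e ∈ elems,
      ofCoeffs₂ a = ofCoeffs₂ (addCoeffs₂ e
    (addCoeffs₂ (mulCoeffs₂ w.1 cf) (mulCoeffs₂ w.2 [powCoeffs cP N]))) := by
    intro a
    obtain ⟨e, he, u, v, h⟩ := hf.exists_isReduced (pow_ne_zero N hP) (ofCoeffs₂ a)
    obtain ⟨u, rfl⟩ := exists_ofCoeffs₂_eq u
    obtain ⟨v, rfl⟩ := exists_ofCoeffs₂_eq v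
    rw [Polynomial.natDegree_pow, mul_comm] at he
    refine ⟨(u, v), e, (helems e).2 he, ?_⟩
    rw [h, ofCoeffs₂_addCoeffs₂, ofCoeffs₂_addCoeffs₂, ofCoeffs₂_mulCoeffs₂, ofCoeffs₂_mulCoeffs₂,
      ofCoeffs₂_singleton, ofCoeffs_powCoeffs, add_assoc]
  choose w hw using hex
  -- The multipliers are found by dividing the required polynomials. These do not depend on the
  -- multipliers, so an empty list serves to name them.
  let M₀ : ModelData k := ((cf, cP), (t, (ofCoeffs₂ cf).natDegree, (ofCoeffs cP).natDegree), elems, [])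
  refine ⟨((cf, cP), (t, (ofCoeffs₂ cf).natDegree, (ofCoeffs cP).natDegree), elems,
    (M₀.required κ).map w), rfl, rfl, ?_, ?_, fun e he => (helems e).1 he, fun a ha => ?_⟩
  · change cP.getD (ofCoeffs cP).natDegree 0 ≠ 0
    rw [← coeff_ofCoeffs]
    exact Polynomial.leadingCoeff_ne_zero.2 hP
  · change ∃ c ∈ cf.getD (ofCoeffs₂ cf).natDegree [], c ≠ 0
    by_contra! h0
    refine Polynomial.leadingCoeff_ne_zero.2 hf.irreducible.ne_zero ?_
    rw [Polynomial.leadingCoeff]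
    nth_rw 1 [ofCoeffs₂]
    rw [coeff_ofCoeffs, getD_map_of_eq (z := []) rfl]
    ext i
    rw [coeff_ofCoeffs, Polynomial.coeff_zero]
    generalize cf.getD (ofCoeffs₂ cf).natDegree [] = l at h0
    by_cases hi : i < l.length
    · rw [List.getD_eq_getElem _ _ hi]
      exact h0 _ (List.getElem_mem hi)
    · exact List.getD_eq_default _ _ (by simpa using hi)
  · obtain ⟨e, he, h⟩ := hw a
    exact ⟨e, he, w a, List.mem_map_of_mem ha, h⟩

/-- A certificate for a model of `k[T][x]/(f)` determines the ideal class monoid. -/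
theorem IsModel.describesICM [Finite k] (hκ : ∀ c, c ∈ κ) (hM : M.IsModel κ)
    (hf : IsCurve (ofCoeffs₂ M.poly)) (hP : ofCoeffs M.prime ≠ 0)
    {out : List (List (List (List k))) × List (List ℕ)} (hout : M.Certifies out) :
    DescribesICM (ofCoeffs₂ M.poly) (ofCoeffs M.prime) out := by
  obtain ⟨e, he, hmul⟩ := (hM.realizes hκ hf hP).exists_equiv_of_certifies hout
  refine ⟨e, fun i => ?_, hmul⟩
  obtain ⟨hI, hc⟩ := he i
  rw [Represents, completedIdeal_map_ofCoeffs₂]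
  exact ⟨fullOfIdeal _ hI, rfl, hc⟩

end ModelData

/-- The bound on representatives enters only here, and only through its existence: it ensures that
the search ends. -/
theorem IsCurve.exists_certificate [Finite k] {cf : List (List k)} {cP : List k}
    (hf : IsCurve (ofCoeffs₂ cf)) (hP : Irreducible (ofCoeffs cP)) {κ : List k}
    (hκ : ∀ c, c ∈ κ) :
    ∃ M : ModelData k, M.1 = (cf, cP) ∧ M.IsModel κ ∧ ∃ out, M.Certifies out := by
  obtain ⟨t, ht⟩ := hf.exists_bound hP
  obtain ⟨M, hM, rfl, hmodel⟩ := ModelData.exists_isModel hf hP.ne_zero κ t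
  refine ⟨M, hM, hmodel, ?_⟩
  obtain ⟨⟨cf', cP'⟩, M'⟩ := M
  cases hM
  exact (hmodel.realizes hκ hf hP.ne_zero).exists_certifies ht

end Realization

/-! ### Unbounded search for certified outputs -/

section Search

variable {α β γ : Type*} [Primcodable α] [Primcodable β] [Primcodable γ]

/-- Outputs that are recognized with the help of certificates can be found by a search. -/
theorem exists_partrec_search {p : α × β × γ → Prop} (hp : PrimrecPred p) :
    ∃ algo : α →. β, Partrec algo ∧ (∀ a, ∀ b ∈ algo a, ∃ c, p (a, b, c)) ∧
      ∀ a, (∃ b c, p (a, b, c)) → ∃ b, b ∈ algo a := by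
  classical
  let F : α → ℕ → Option β := fun a n => (Encodable.decode (α := β × γ) n).bind fun x =>
    if p (a, x) then some x.1 else none
  have hF : Primrec₂ F := by
    refine Primrec.option_bind (Primrec.decode.comp Primrec.snd) ?_
    refine Primrec.ite (c := fun x : (α × ℕ) × β × γ => p (x.1.1, x.2)) ?_ ?_ (Primrec.const _)
    · exact hp.comp (f := fun x : (α × ℕ) × β × γ => (x.1.1, x.2)) (by fun_prop)
    · fun_prop
  refine ⟨fun a => Nat.rfindOpt (F a), Partrec.rfindOpt hF.to_comp, fun a b hb => ?_,
    fun a ⟨b, c, h⟩ => Part.dom_iff_mem.1 (Nat.rfindOpt_dom.2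
      ⟨Encodable.encode (b, c), b, by simp [F, h]⟩)⟩
  obtain ⟨n, hn⟩ := Nat.rfindOpt_spec hb
  obtain ⟨x, -, hx⟩ := Option.bind_eq_some_iff.1 (Option.mem_def.1 hn)
  split_ifs at hx with h
  cases hx
  exact ⟨x.2, h⟩

end Search
end IdealClasses

/-- Over `A = k[T]` with `k` a finite field, there is one algorithm which, given the coefficients
of any irreducible `f` in `A[x]` whose leading coefficient is a unit (so that `R = A[x]/(f)` is an
`A`-order) and of any irreducible `P` in `A`, halts and returns the
ideal class monoid of the completion of `R` at `P`. -/
theorem mainTheorem1 {k : Type*} [Field k] [Finite k] [Primcodable k] :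
    ∃ algo : List (List k) × List k →. List (List (List (List k))) × List (List ℕ),
      Partrec algo ∧
      ∀ (cf : List (List k)) (cP : List k),
        IsUnit (IdealClasses.ofCoeffs₂ cf).leadingCoeff → Irreducible (IdealClasses.ofCoeffs₂ cf) →
        Irreducible (IdealClasses.ofCoeffs cP) →
        ∃ out ∈ algo (cf, cP),
          IdealClasses.DescribesICM (IdealClasses.ofCoeffs₂ cf) (IdealClasses.ofCoeffs cP) out := by
  open IdealClasses in
  obtain ⟨κ, hκ⟩ : ∃ κ : List k, ∀ c, c ∈ κ :=
    ⟨Set.finite_univ.toFinset.toList, by simp⟩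
  have hp : PrimrecPred fun x : (List (List k) × List k) ×
      (List (List (List (List k))) × List (List ℕ)) × ModelData k =>
      x.2.2.1 = x.1 ∧ x.2.2.IsModel κ ∧ x.2.2.Certifies x.2.1 := by
    refine .and (primrecPred_eq (by fun_prop) (by fun_prop)) (.and ?_ ?_)
    · exact (ModelData.primrecPred_isModel κ).comp (by fun_prop)
    · exact ModelData.primrecPred_certifies.comp (f := fun x : (List (List k) × List k) ×
        (List (List (List (List k))) × List (List ℕ)) × ModelData k => (x.2.2, x.2.1)) (by fun_prop)
  obtain ⟨algo, halgo, hsound, hcomplete⟩ := exists_partrec_search hp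
  refine ⟨algo, halgo, fun cf cP hlead hirr hP => ?_⟩
  have hf : IsCurve (ofCoeffs₂ cf) := ⟨hlead, hirr⟩
  obtain ⟨M, hM, hmodel, out, hout⟩ := hf.exists_certificate hP hκ
  -- The output that the search finds may differ from the one constructed, but it comes with an
  -- accepted certificate of its own.
  obtain ⟨out, hmem⟩ := hcomplete (cf, cP) ⟨out, M, hM, hmodel, hout⟩
  obtain ⟨⟨⟨cf', cP'⟩, M⟩, hM, hmodel, hout⟩ := hsound _ _ hmem
  cases hM
  exact ⟨out, hmem, hmodel.describesICM hκ hf hP.ne_zero hout⟩
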